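/- Let $n,N\ge 0$ be integers, $q\in\mathbb C$ with $q\neq 0$, $q^2\neq 1$; put $\mathfrak a(x)=qx-(qx)^{-1}$, $\mathfrak b(x)=x-x^{-1}$, and let $R(x)\in \mathrm{End}(\mathbb C^n)^{\otimes 2}$ be $$R(x)=\mathfrak a(x)\sum_a E_{aa}\otimes E_{aa}+\mathfrak b(x)\sum_{a\ne b}E_{aa}\otimes E_{bb}+(q-q^{-1})\sum_{a\neq b}x^{\mathrm{sgn}(b-a)}E_{ab}\otimes E_{ba}.$$ Let $V_1,\dots,V_N$ be complex vector spaces, $W=V_1\otimes\cdots\otimes V_N$, and let $t_1,\dots,t_N\in\mathbb C^\times$ (inhomogeneities $t_i=q^{a_i}$). For each $i$ let $\mathcal L_i(z)$ be an $n\times n$ matrix with entries in $\mathrm{End}(V_i)$, Laurent polynomial in $z$, with $R_{12}(z/w)\mathcal L_{i,1}(z)\mathcal L_{i,2}(w)=\mathcal L_{i,2}(w)\mathcal L_{i,1}(z)R_{12}(z/w)$ for all $z,w\ne0$. Put $\mathcal T(z)=\mathcal L_{1}(zt_1)\mathcal L_{2}(zt_2)\cdots\mathcal L_{N}(zt_N)$,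 a matrix $(T_{ab}(z))$ with entries in $\mathrm{End}(W)$. A highest weight vector of $\mathcal T(z)$ with eigenvalues $P_1(z),\dots,P_n(z)$ is a nonzero $\omega\in W$ with $T_{ab}(z)\omega=0$ for $b<a$ and $T_{aa}(z)\omega=P_a(z)\omega$, for all $z\neq0$. Let $0\le M,M_+\le n$, $\xi,\xi_+\in\mathbb C$, and $$\alpha(z)=z^2(z^2-\xi^2),\quad \beta(z)=1-\xi^2z^2,\quad \tilde\alpha(z)=1-q^n\xi_+^2z^2,\quad \tilde\beta(z)=q^nz^2(q^nz^2-\xi_+^2).$$ Let $K(z)$ be the diagonal matrix whose first $M$ diagonal entries are $\alpha(z)$ and whose other entries are $\beta(z)$, and let $K^+(z)$ be the diagonal matrix with $k$-th entry $q^{n+1-2k}\tilde\alpha(z)$ for $k\le M_+$ and $q^{n+1-2k}\tilde\beta(z)$ for $k>M_+$. The open-chain transfer matrix is $$b(z)=\mathrm{tr}\big(K^+(z)\mathcal B(z)\big),\qquad \mathcal B(z)=\mathcal T(z)K(z)\mathcal T(z^{-1})^{-1}.$$ Put $$\hat P_i(z)=\Big(\prod_{a=1}^{i-1}\frac{P_a(zq^{-a})}{P_a(zq^{-a+1})}\Big)\frac1{P_i(zq^{-i+1})},\qquad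 \Gamma_k(z)=\frac{q^{k-1}\mathfrak b(z^2)}{\mathfrak b(q^{k-1}z^2)}\times\begin{cases}\alpha(z)&k\le M\\ q^{-2M}\beta(zq^M)&k>M,\end{cases}$$ $$g_j(z)=\Gamma_j(z)\,q^{-j+1}\frac{\mathfrak b(q^nz^2)}{\mathfrak b(q^jz^2)}\times\begin{cases}q^{2n-2M_+}\tilde\alpha(zq^{M_+-n})&j\le M_+\\ \tilde\beta(z)&j>M_+,\end{cases}\qquad \Lambda^0(z)=\sum_{j=1}^n g_j(z)P_j(z)\hat P_j(z^{-1}).$$ Call $z\in\mathbb C$ regular if $z\ne0$, $\mathcal T(z^{-1})$ is invertible, $\mathfrak b(q^kz^2)\neq0$ for $0\le k\le n$, and $P_a(z^{-1}q^{-a+1})\ne0$ for $1\le a\le n$. (1) If $\omega$ is a highest weight vector of $\mathcal T(z)$ with eigenvalues $P_1(z),\dots,P_n(z)$, then for every regular $z$ it is an eigenvector of $b(z)$ with eigenvalue $\Lambda^0(z)$: $b(z)\,\omega=\Lambda^0(z)\,\omega$. (2) In particular, let $V_i$ be finite-dimensional representations of $U_q(gl_n)$, given by an upper triangular matrix $\mathcal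 L_i^+=(\ell^+_{ab})$ and a lower triangular matrix $\mathcal L_i^-=(\ell^-_{ab})$ of operators on $V_i$ with $\ell^+_{aa}\ell^-_{aa}=\ell^-_{aa}\ell^+_{aa}=1$ and $R_{12}\mathcal L^{\epsilon}_{i,1}\mathcal L^{\epsilon'}_{i,2}=\mathcal L^{\epsilon'}_{i,2}\mathcal L^{\epsilon}_{i,1}R_{12}$ for $(\epsilon,\epsilon')=(+,+),(+,-),(-,-)$, where $R_{12}=q\sum_aE_{aa}\otimes E_{aa}+\sum_{a\ne b}E_{aa}\otimes E_{bb}+(q-q^{-1})\sum_{a<b}E_{ab}\otimes E_{ba}$. Take $\mathcal L_i(z)=z\mathcal L_i^+-z^{-1}\mathcal L_i^-$. Let $v_i\in V_i$ be a highest weight vector: $v_i\neq0$, $\ell^-_{ab}v_i=0$ for $b<a$, $\ell^-_{aa}v_i=(\lambda^{(i)}_a)^{-1}v_i$ with $\lambda_a^{(i)}\in\mathbb C^\times$ (that is, $\lambda^{(i)}_a=q^{\varpi^{(i)}_a}$). Put $P_a(z)=\prod_{i=1}^N\big(zt_i\lambda_a^{(i)}-(zt_i\lambda_a^{(i)})^{-1}\big)$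 and $\omega=v_1\otimes\cdots\otimes v_N$. Then all but finitely many $z\in\mathbb C$ are regular, and for every regular $z$ the vector $\omega$ is an eigenvector of $b(z)$ with eigenvalue $\Lambda^0(z)$. -/

import Mathlib

open scoped TensorProduct Kronecker

noncomputable section

namespace OpenChain

/-- `𝔟(x) = x - x⁻¹`. -/
def bfun (x : ℂ) : ℂ := x - x⁻¹

/-- `𝔞(x) = q x - (q x)⁻¹`. -/
def afun (q x : ℂ) : ℂ := q * x - (q * x)⁻¹

/-- The finite `R`-matrix of `U_q(gl_n)`,
`q ∑ E_aa ⊗ E_aa + ∑_{a ≠ b} E_aa ⊗ E_bb + (q - q⁻¹) ∑_{a < b} E_ab ⊗ E_ba`,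
with rows and columns indexed by pairs (first space, second space). -/
def Rfin (n : ℕ) (q : ℂ) : Matrix (Fin n × Fin n) (Fin n × Fin n) ℂ :=
  Matrix.of fun r s =>
    if r = s then (if r.1 = r.2 then q else 1)
    else if r.1 = s.2 ∧ r.2 = s.1 ∧ r.1 < r.2 then q - q⁻¹
    else 0

/-- The affine `R`-matrix,
`𝔞(x) ∑ E_aa ⊗ E_aa + 𝔟(x) ∑_{a ≠ b} E_aa ⊗ E_bb
  + (q - q⁻¹) ∑_{a ≠ b} x ^ sgn(b - a) E_ab ⊗ E_ba`. -/
def Raff (n : ℕ) (q x : ℂ) : Matrix (Fin n × Fin n) (Fin n × Fin n) ℂ :=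
  Matrix.of fun r s =>
    if r = s then (if r.1 = r.2 then afun q x else bfun x)
    else if r.1 = s.2 ∧ r.2 = s.1 then
      (q - q⁻¹) * (if r.1 < r.2 then x else x⁻¹)
    else 0

section Legs

variable {n : ℕ} {A : Type*} [Ring A] [Algebra ℂ A]

/-- `X₁ = X ⊗ 1`: an operator-valued matrix placed in the first auxiliary space. -/
def leg1 (X : Matrix (Fin n) (Fin n) A) : Matrix (Fin n × Fin n) (Fin n × Fin n) A :=
  X ⊗ₖ (1 : Matrix (Fin n) (Fin n) A)

/-- `X₂ = 1 ⊗ X`: an operator-valued matrix placed in the second auxiliary space. -/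
def leg2 (X : Matrix (Fin n) (Fin n) A) : Matrix (Fin n × Fin n) (Fin n × Fin n) A :=
  (1 : Matrix (Fin n) (Fin n) A) ⊗ₖ X

/-- The exchange relation `R X₁ Y₂ = Y₂ X₁ R`, with the numerical matrix `R` acting on the two
auxiliary spaces. -/
def Exchange (R : Matrix (Fin n × Fin n) (Fin n × Fin n) ℂ) (X Y : Matrix (Fin n) (Fin n) A) :
    Prop :=
  R.map (algebraMap ℂ A) * leg1 X * leg2 Y = leg2 Y * leg1 X * R.map (algebraMap ℂ A)

end Legs

/-- A representation of `U_q(gl_n)` on `V`, in terms of the generators `ℓ⁺_ab`, `ℓ⁻_ab`. -/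
structure UqGlRep (n : ℕ) (q : ℂ) (V : Type*) [AddCommGroup V] [Module ℂ V] where
  /-- the matrix `ℒ⁺` of the operators `ℓ⁺_ab` -/
  ellP : Matrix (Fin n) (Fin n) (Module.End ℂ V)
  /-- the matrix `ℒ⁻` of the operators `ℓ⁻_ab` -/
  ellM : Matrix (Fin n) (Fin n) (Module.End ℂ V)
  upper : ∀ a b, b < a → ellP a b = 0
  lower : ∀ a b, a < b → ellM a b = 0
  diag_mul : ∀ a, ellP a a * ellM a a = 1
  diag_mul' : ∀ a, ellM a a * ellP a a = 1
  exch_PP : Exchange (Rfin n q) ellP ellP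
  exch_PM : Exchange (Rfin n q) ellP ellM
  exch_MM : Exchange (Rfin n q) ellM ellM

/-- The Lax operator `ℒ(z) = z ℒ⁺ - z⁻¹ ℒ⁻` of the evaluation representation. -/
def UqGlRep.lax {n : ℕ} {q : ℂ} {V : Type*} [AddCommGroup V] [Module ℂ V]
    (ρ : UqGlRep n q V) (z : ℂ) : Matrix (Fin n) (Fin n) (Module.End ℂ V) :=
  z • ρ.ellP - z⁻¹ • ρ.ellM

/-- `v` is a highest weight vector of the `U_q(gl_n)`-representation `ρ`:
`ℓ⁻_ab v = 0` for `b < a` and `ℓ⁻_aa v = (lam a)⁻¹ v`, where `lam a` stands for `q ^ ϖ_a`. -/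
structure UqGlRep.IsHighestWeight {n : ℕ} {q : ℂ} {V : Type*} [AddCommGroup V] [Module ℂ V]
    (ρ : UqGlRep n q V) (v : V) (lam : Fin n → ℂ) : Prop where
  ne_zero : v ≠ 0
  lam_ne_zero : ∀ a, lam a ≠ 0
  lower : ∀ a b, b < a → ρ.ellM a b v = 0
  diag : ∀ a, ρ.ellM a a v = (lam a)⁻¹ • v

/-- `L` is an `L`-operator on `V` for the affine `R`-matrix, i.e. the generating matrix `ℒ(z)` of
a representation of `U_q(gl_n^)` at central charge zero: an operator-valued matrix with Laurent
polynomial dependence on `z` and `R₁₂(z/w) ℒ₁(z) ℒ₂(w) = ℒ₂(w) ℒ₁(z) R₁₂(z/w)`. -/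
structure IsLaxOperator {n : ℕ} (q : ℂ) {V : Type*} [AddCommGroup V] [Module ℂ V]
    (L : ℂ → Matrix (Fin n) (Fin n) (Module.End ℂ V)) : Prop where
  laurent : ∃ (d : ℕ) (c : ℤ → Matrix (Fin n) (Fin n) (Module.End ℂ V)),
    ∀ z : ℂ, z ≠ 0 → L z = ∑ m ∈ Finset.Icc (-(d : ℤ)) d, z ^ m • c m
  exchange : ∀ z w : ℂ, z ≠ 0 → w ≠ 0 → Exchange (Raff n q (z / w)) (L z) (L w)

section Chain

variable {n N : ℕ} {V : Fin N → Type*} [∀ i, AddCommGroup (V i)] [∀ i, Module ℂ (V i)]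

/-- The operator on `⨂ V i` acting as `f` on the site `i` and as the identity elsewhere. -/
def siteOp (i : Fin N) (f : Module.End ℂ (V i)) : Module.End ℂ (⨂[ℂ] j, V j) :=
  PiTensorProduct.map (Function.update (fun j => (LinearMap.id : V j →ₗ[ℂ] V j)) i f)

/-- The monodromy matrix `𝒯(z) = ℒ₀₁(z t₁) ℒ₀₂(z t₂) ⋯ ℒ₀N(z t_N)`, a product of matrices in the
auxiliary space; `t i` stands for `q ^ a_i`, with inhomogeneity parameter `a_i`. -/
def monodromy (t : Fin N → ℂ) (L : ∀ i, ℂ → Matrix (Fin n) (Fin n) (Module.End ℂ (V i)))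
    (z : ℂ) : Matrix (Fin n) (Fin n) (Module.End ℂ (⨂[ℂ] j, V j)) :=
  (List.ofFn fun i => (L i (z * t i)).map (siteOp i)).prod

end Chain

section Boundary

variable {n : ℕ} {W : Type*} [AddCommGroup W] [Module ℂ W]

/-- `ω` is a highest weight vector of `𝒯(z)`, with eigenvalues `P_a(z)`. -/
structure IsHighestWeight (T : ℂ → Matrix (Fin n) (Fin n) (Module.End ℂ W)) (ω : W)
    (P : Fin n → ℂ → ℂ) : Prop where
  ne_zero : ω ≠ 0
  lower : ∀ z : ℂ, z ≠ 0 → ∀ a b, b < a → T z a b ω = 0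
  diag : ∀ z : ℂ, z ≠ 0 → ∀ a, T z a a ω = P a z • ω

/-- `α(z; ξ) = z² (z² - ξ²)`. -/
def alpha (ξ z : ℂ) : ℂ := z ^ 2 * (z ^ 2 - ξ ^ 2)

/-- `β(z; ξ) = 1 - ξ² z²`. -/
def beta (ξ z : ℂ) : ℂ := 1 - ξ ^ 2 * z ^ 2

/-- `α̃(z; ξ₊) = 1 - (ρ ξ₊ z)²`, where `ρ² = q ^ n`. -/
def alphaT (n : ℕ) (q ξ z : ℂ) : ℂ := 1 - q ^ n * (ξ * z) ^ 2

/-- `β̃(z; ξ₊) = (ρ z)² ((ρ z)² - ξ₊²)`, where `ρ² = q ^ n`. -/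
def betaT (n : ℕ) (q ξ z : ℂ) : ℂ := q ^ n * z ^ 2 * (q ^ n * z ^ 2 - ξ ^ 2)

/-- The diagonal of `K(z) = diag(α, …, α, β, …, β)`, with `M` entries `α`. -/
def Kdiag (M : ℕ) (ξ z : ℂ) (a : Fin n) : ℂ :=
  if (a : ℕ) < M then alpha ξ z else beta ξ z

/-- The diagonal of `K⁺(z) = q^(n+1) diag(q⁻² α̃, …, q^(-2M₊) α̃, q^(-2M₊-2) β̃, …, q^(-2n) β̃)`,
with `Mp = M₊` entries containing `α̃`. The `k`-th entry has index `k - 1 : Fin n`. -/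
def Kplus (q : ℂ) (Mp : ℕ) (ξp z : ℂ) (a : Fin n) : ℂ :=
  q ^ (n + 1) * q ^ (-2 * ((a : ℤ) + 1)) *
    (if (a : ℕ) < Mp then alphaT n q ξp z else betaT n q ξp z)

/-- A numerical diagonal matrix, acting as scalars on the quantum space. -/
def scalarDiag (W : Type*) [AddCommGroup W] [Module ℂ W] (k : Fin n → ℂ) :
    Matrix (Fin n) (Fin n) (Module.End ℂ W) :=
  Matrix.diagonal fun a => algebraMap ℂ (Module.End ℂ W) (k a)

/-- `ℬ(z) = 𝒯(z) K(z) 𝒯(z⁻¹)⁻¹`; the inverse is that of the ring of operator-valued matrices, and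
it is meaningful when `𝒯(z⁻¹)` is a unit. -/
def reflMonodromy (M : ℕ) (ξ : ℂ) (T : ℂ → Matrix (Fin n) (Fin n) (Module.End ℂ W)) (z : ℂ) :
    Matrix (Fin n) (Fin n) (Module.End ℂ W) :=
  T z * scalarDiag W (Kdiag M ξ z) * Ring.inverse (T z⁻¹)

/-- The transfer matrix `b(z) = tr₀ (K⁺(z) ℬ(z))` of the open chain. -/
def transfer (q : ℂ) (M Mp : ℕ) (ξ ξp : ℂ)
    (T : ℂ → Matrix (Fin n) (Fin n) (Module.End ℂ W)) (z : ℂ) : Module.End ℂ W :=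
  Matrix.trace (scalarDiag W (Kplus q Mp ξp z) * reflMonodromy M ξ T z)

end Boundary

section Eigenvalue

variable {n : ℕ}

/-- `P̂_i(z) = (∏_{a < i} P_a(z q^(-a)) / P_a(z q^(-a+1))) / P_i(z q^(-i+1))`, for `a` and `i`
numbered from `1`; the number `k` is `k - 1 : Fin n` here. -/
def Phat (q : ℂ) (P : Fin n → ℂ → ℂ) (i : Fin n) (z : ℂ) : ℂ :=
  (∏ a ∈ Finset.univ.filter (fun a : Fin n => a < i),
      P a (z * q ^ (-((a : ℤ) + 1))) / P a (z * q ^ (-(a : ℤ)))) *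
    (1 / P i (z * q ^ (-(i : ℤ))))

/-- `Γ_k(z) = q^(k-1) 𝔟(z²) / 𝔟(q^(k-1) z²)` times `α(z; ξ)` if `k ≤ M` and times
`q^(-2M) β(z q^M; ξ)` if `k > M`; the number `k` is `k - 1 : Fin n` here. -/
def Gam (q : ℂ) (M : ℕ) (ξ : ℂ) (k : Fin n) (z : ℂ) : ℂ :=
  q ^ (k : ℕ) * bfun (z ^ 2) / bfun (q ^ (k : ℕ) * z ^ 2) *
    (if (k : ℕ) < M then alpha ξ z else q ^ (-2 * (M : ℤ)) * beta ξ (z * q ^ M))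

/-- `g_j(z) = Γ_j(z) q^(-j+1) 𝔟(q^n z²) / 𝔟(q^j z²)` times
`q^(2n - 2M₊) α̃(z q^(M₊ - n); ξ₊)` if `j ≤ M₊` and times `β̃(z; ξ₊)` if `j > M₊`;
the number `j` is `j - 1 : Fin n` here. -/
def gfun (q : ℂ) (M Mp : ℕ) (ξ ξp : ℂ) (j : Fin n) (z : ℂ) : ℂ :=
  Gam q M ξ j z * q ^ (-(j : ℤ)) * (bfun (q ^ n * z ^ 2) / bfun (q ^ ((j : ℕ) + 1) * z ^ 2)) *
    (if (j : ℕ) < Mp then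
      q ^ (2 * (n : ℤ) - 2 * (Mp : ℤ)) * alphaT n q ξp (z * q ^ ((Mp : ℤ) - (n : ℤ)))
    else betaT n q ξp z)

/-- `Λ⁰(z) = ∑_j g_j(z) P_j(z) P̂_j(z⁻¹)`. -/
def Lambda0 (q : ℂ) (M Mp : ℕ) (ξ ξp : ℂ) (P : Fin n → ℂ → ℂ) (z : ℂ) : ℂ :=
  ∑ j : Fin n, gfun q M Mp ξ ξp j z * P j z * Phat q P j z⁻¹

/-- The spectral parameters at which `𝒯(z⁻¹)` is invertible, so that `b(z)` is defined, and no
denominator in `Γ_j(z)`, `g_j(z)`, `P̂_j(z⁻¹)` vanishes. -/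
structure Regular (q : ℂ) {W : Type*} [AddCommGroup W] [Module ℂ W]
    (T : ℂ → Matrix (Fin n) (Fin n) (Module.End ℂ W)) (P : Fin n → ℂ → ℂ) (z : ℂ) : Prop where
  ne_zero : z ≠ 0
  isUnit : IsUnit (T z⁻¹)
  bfun_ne_zero : ∀ k : ℕ, k ≤ n → bfun (q ^ k * z ^ 2) ≠ 0
  weight_ne_zero : ∀ a : Fin n, P a (z⁻¹ * q ^ (-(a : ℤ))) ≠ 0

/-- The highest weight `P_a(z) = ∏_i (z q^(a_i + ϖ_a^(i)) - z⁻¹ q^(-a_i - ϖ_a^(i)))` of the chain of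
evaluation representations, with `t i = q ^ a_i` and `lam i a = q ^ ϖ_a^(i)`. -/
def chainWeight {N : ℕ} (t : Fin N → ℂ) (lam : Fin N → Fin n → ℂ) (a : Fin n) (z : ℂ) : ℂ :=
  ∏ i, (z * (t i * lam i a) - z⁻¹ * (t i * lam i a)⁻¹)

end Eigenvalue

end OpenChain

end

/-! Write `S` for the inverse of `T w`. Multiplying the exchange relation by `S` in the second
auxiliary space on both sides gives an exchange relation between `T z` and `S`, with no inverse of
the `R`-matrix. Applied to `ω`, its entries are linear equations on the families `S c f (T z f c ω)`
and `T z e f (S f e ω)` indexed by `f`. Their left-hand sides are the combinations `row`, which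
involve only the total of the family and two consecutive partial sums (`row_eq`). A family with
vanishing rows therefore satisfies a first-order recursion, which is solved in closed form.

This is used twice. With `w` fixed and `z` varying, induction on the column shows that `S` is upper
triangular on `ω` with diagonal `Phat` (`inverse_apply`): at `z = w * q ^ (-a')` the unknown total
drops out, and the last entry is the one wanted. The factor `bfun (z / w)` may vanish there when `q`
is a root of unity, so it is first divided out of an identity of Laurent polynomials; this is why `q
^ 2 ≠ 1` suffices. With `w = z⁻¹`, the difference of the families that make up two consecutive
diagonal entries of the reflection monodromy matrix is a solved family. Since `K` is a step
function, weighting by `K` needs only one partial sum, and induction gives the diagonal entries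
(`reflMonodromy_apply`). The trace with `K⁺` is then a telescoping geometric sum
(`sum_Kplus_mul_reflWeight`).

For the chain, the exchange relation and the highest weight property pass to products of commuting
sites. Evaluation representations satisfy the affine relation by Baxterization of the Hecke
relation, and only finitely many spectral parameters are irregular because the spectrum of `(ℒ⁻)⁻¹
ℒ⁺` is finite. -/

namespace OpenChain

/-! ### Linear algebra of the rows of the exchange relation. -/

section Row

variable {n : ℕ} {W : Type*} [AddCommGroup W]

/-- The sum of the entries of `X` with index less than `k`. -/
def partialSum (X : Fin n → W) (k : ℕ) : W := ∑ f : Fin n, if (f : ℕ) < k then X f else 0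

lemma partialSum_zero (X : Fin n → W) : partialSum X 0 = 0 := by
  simp [partialSum]

lemma partialSum_succ (X : Fin n → W) (e : Fin n) :
    partialSum X (e + 1) = partialSum X e + X e := by
  have : X e = ∑ f, if f = e then X f else 0 := by simp
  rw [this, partialSum, partialSum, ← Finset.sum_add_distrib]
  refine Finset.sum_congr rfl fun f _ => ?_
  by_cases h : f = e
  · subst h; simp
  · have : (f : ℕ) ≠ e := fun h' => h (Fin.ext h')
    have h2 : (f : ℕ) < e + 1 ↔ (f : ℕ) < e := by omega
    simp [h, h2]

lemma partialSum_eq_sum (X : Fin n → W) {k : ℕ} (h : ∀ f : Fin n, k ≤ f → X f = 0) :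
    partialSum X k = ∑ f, X f := by
  refine Finset.sum_congr rfl fun f _ => ?_
  split_ifs with hf
  · rfl
  · exact (h f (by omega)).symm

variable [Module ℂ W]

/-- The combination `𝔞(x) X_e + (q - q⁻¹) ∑_{f ≠ e} x ^ sgn(f - e) X_f` of the entries of `X`. -/
noncomputable def row (q x : ℂ) (X : Fin n → W) (e : Fin n) : W :=
  ∑ f, (if f = e then afun q x else (q - q⁻¹) * (if e < f then x else x⁻¹)) • X f

lemma row_sub (q x : ℂ) (X Y : Fin n → W) (e : Fin n) :
    row q x (X - Y) e = row q x X e - row q x Y e := by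
  simp [row, smul_sub]

/-- The coefficients of a row are constant before `e` and constant after `e`, so summation by parts
leaves the total and the partial sums on either side of `e`. Equations on rows become recursions for
partial sums. -/
lemma row_eq {q x : ℂ} (hq : q ≠ 0) (hx : x ≠ 0) (X : Fin n → W) (e : Fin n) :
    row q x X e = ((q - q⁻¹) * x) • ∑ f, X f +
      bfun x • (q⁻¹ • partialSum X (e + 1) - q • partialSum X e) := by
  simp only [row, partialSum, Finset.smul_sum, ← Finset.sum_sub_distrib, ← Finset.sum_add_distrib]
  refine Finset.sum_congr rfl fun f _ => ?_
  rcases lt_trichotomy (f : ℕ) e with h | h | h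
  · have h1 : ¬ f = e := fun h' => by simp [h'] at h
    have h2 : ¬ e < f := by rw [Fin.lt_def]; omega
    have h3 : (f : ℕ) < e + 1 := by omega
    simp only [h1, h2, h3, h, if_true, if_false, bfun]
    match_scalars
    field_simp
    ring
  · have h1 : f = e := Fin.ext h
    subst h1
    simp only [lt_irrefl, Nat.lt_succ_self, if_true, if_false, bfun, afun]
    match_scalars
    field_simp
    ring
  · have h1 : ¬ f = e := fun h' => by simp [h'] at h
    have h2 : e < f := h
    have h3 : ¬ (f : ℕ) < e + 1 := by omega
    have h4 : ¬ (f : ℕ) < e := by omega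
    simp [h1, h2, h3, h4]

/-- A row all of whose entries beyond `c < e` vanish only sees the total. -/
lemma row_of_support_lt (q x : ℂ) (X : Fin n → W) {c e : Fin n} (hce : c < e)
    (h : ∀ f, c < f → X f = 0) : row q x X e = ((q - q⁻¹) * x⁻¹) • ∑ f, X f := by
  rw [row, Finset.smul_sum]
  refine Finset.sum_congr rfl fun f _ => ?_
  by_cases hf : c < f
  · simp [h f hf]
  · have h1 : ¬ f = e := fun h' => hf (h' ▸ hce)
    have h2 : ¬ e < f := fun h' => hf (hce.trans h')
    simp [h1, h2]

lemma row_of_support_le {q x : ℂ} (hq : q ≠ 0) (hx : x ≠ 0) (X : Fin n → W) {e : Fin n}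
    (h : ∀ f, e < f → X f = 0) :
    row q x X e = ((q - q⁻¹) * x⁻¹) • ∑ f, X f + (q * bfun x) • X e := by
  have : X e = ∑ f, if f = e then X f else 0 := by simp
  rw [row, this, Finset.smul_sum, Finset.smul_sum, ← Finset.sum_add_distrib]
  refine Finset.sum_congr rfl fun f _ => ?_
  by_cases h1 : f = e
  · subst h1
    simp only [if_true, bfun, afun]
    match_scalars
    field_simp
    ring
  · by_cases hf : e < f
    · simp [h f hf]
    · simp [h1, hf]

lemma bfun_inv (x : ℂ) : bfun x⁻¹ = -bfun x := by simp [bfun]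

/-- Vanishing of row `e` says that the partial sum at `e + 1` is `q ^ 2` times the one at `e` plus a
multiple of the total; the geometric series sums to `q ^ (2 * k) - 1`. The factor `bfun x` is kept
on the left because it may vanish. -/
lemma bfun_smul_partialSum {q x : ℂ} (hq : q ≠ 0) (hx : x ≠ 0) (D : Fin n → W) {a : Fin n}
    (h0 : ∀ e < a, row q x D e = 0) {k : ℕ} (hk : k ≤ a) :
    bfun x • partialSum D k = -(x * (q ^ (2 * k) - 1)) • ∑ f, D f := by
  induction k with
  | zero => simp [partialSum_zero]
  | succ k ih =>
    have hka : (⟨k, by omega⟩ : Fin n) < a := by rw [Fin.lt_def]; simp; omega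
    have h1 := h0 _ hka
    rw [row_eq hq hx] at h1
    simp only at h1
    have h2 := ih (by omega)
    have h3 : bfun x • partialSum D (k + 1) =
        q • (bfun x • (q⁻¹ • partialSum D (k + 1) - q • partialSum D k)) +
          q ^ 2 • (bfun x • partialSum D k) := by
      match_scalars
      · field_simp
      · ring
    rw [h3, h2, eq_neg_of_add_eq_zero_right h1]
    match_scalars
    field_simp
    ring

lemma total_of_row {q x : ℂ} (hq : q ≠ 0) (hx : x ≠ 0) (D : Fin n → W) (Z : W) {a : Fin n}
    (ha : row q x D a = -(q⁻¹ * bfun x) • Z) :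
    ((q - q⁻¹) * x) • ∑ f, D f =
      -bfun x • (q⁻¹ • Z + q⁻¹ • partialSum D (a + 1) - q • partialSum D a) := by
  rw [row_eq hq hx] at ha
  rw [eq_sub_of_add_eq ha]
  module

/-- The last entry of a family on which all rows but the last one vanish. -/
lemma bfun_smul_last {q x : ℂ} (hq : q ≠ 0) (hx : x ≠ 0) (D : Fin n → W) (Z : W)
    {a a' : Fin n} (haa : (a' : ℕ) = a + 1) (hs : ∀ f, a' < f → D f = 0)
    (h0 : ∀ e < a, row q x D e = 0) (ha : row q x D a = -(q⁻¹ * bfun x) • Z) :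
    bfun x • (D a' - Z) = (q ^ (2 * (a' : ℕ)) * x - x⁻¹) • ∑ f, D f := by
  have h1 := total_of_row hq hx D Z ha
  have h2 := bfun_smul_partialSum hq hx D h0 le_rfl
  -- Nothing lies beyond `a'`, so the partial sum that stops just before `a'` is the total minus the
  -- last entry.
  have h3 : partialSum D (a + 1) = ∑ f, D f - D a' := by
    rw [← partialSum_eq_sum D (k := a' + 1) fun f hf => hs f hf, partialSum_succ D a', haa,
      add_sub_cancel_right]
  rw [h3] at h1
  have h4 : bfun x • (D a' - Z) = q • (((q - q⁻¹) * x) • ∑ f, D f + (q⁻¹ * bfun x) • ∑ f, D f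
      - q • (bfun x • partialSum D a)) := by
    rw [h1]
    match_scalars <;> field_simp <;> ring
  rw [h4, h2, haa, bfun]
  match_scalars
  field_simp
  ring

end Row

/-! ### Exchange relations between a monodromy matrix and an inverse. -/

section Exchange

variable {n : ℕ} {A : Type*} [Ring A]

lemma leg1_mul (X Y : Matrix (Fin n) (Fin n) A) : leg1 (X * Y) = leg1 X * leg1 Y := by
  ext ⟨i, j⟩ ⟨k, l⟩
  simp only [leg1, Matrix.mul_apply, Matrix.kroneckerMap_apply, Matrix.one_apply,
    Fintype.sum_prod_type, ite_mul, mul_ite, mul_one, zero_mul, mul_zero]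
  by_cases hjl : j = l
  · subst hjl; simp
  · simp [hjl]

lemma leg2_mul (X Y : Matrix (Fin n) (Fin n) A) : leg2 (X * Y) = leg2 X * leg2 Y := by
  ext ⟨i, j⟩ ⟨k, l⟩
  simp only [leg2, Matrix.mul_apply, Matrix.kroneckerMap_apply, Matrix.one_apply,
    Fintype.sum_prod_type, ite_mul, mul_ite, one_mul, zero_mul, mul_zero]
  by_cases hik : i = k
  · subst hik; simp
  · simp [hik]

lemma leg1_one : leg1 (1 : Matrix (Fin n) (Fin n) A) = 1 :=
  Matrix.one_kronecker_one

lemma leg2_one : leg2 (1 : Matrix (Fin n) (Fin n) A) = 1 :=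
  Matrix.one_kronecker_one

variable [Algebra ℂ A]

lemma Raff_swap (q x : ℂ) (e f : Fin n) :
    Raff n q x (e, f) (f, e) =
      if f = e then afun q x else (q - q⁻¹) * (if e < f then x else x⁻¹) := by
  by_cases h : f = e
  · subst h; simp [Raff]
  · have : ¬ (e = f) := fun h' => h h'.symm
    simp [Raff, h, this]

/-- Multiplying `R X₁ Y₂ = Y₂ X₁ R` by `S₂` on both sides gives `S₂ R X₁ = X₁ R S₂`; the entries of
`R` are scalars and can be pulled out. -/
lemma exchange_inverse {R : Matrix (Fin n × Fin n) (Fin n × Fin n) ℂ}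
    {X Y S : Matrix (Fin n) (Fin n) A} (h : Exchange R X Y) (h1 : S * Y = 1) (h2 : Y * S = 1)
    (a b c d : Fin n) :
    ∑ r : Fin n × Fin n, R (a, r.2) (r.1, d) • (S b r.2 * X r.1 c) =
      ∑ r : Fin n × Fin n, R (r.1, b) (c, r.2) • (X a r.1 * S r.2 d) := by
  have k1 : leg2 S * leg2 Y = 1 := by rw [← leg2_mul, h1, leg2_one]
  have k2 : leg2 Y * leg2 S = 1 := by rw [← leg2_mul, h2, leg2_one]
  have key : leg2 S * R.map (algebraMap ℂ A) * leg1 X =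
      leg1 X * R.map (algebraMap ℂ A) * leg2 S := by
    have h' : R.map (algebraMap ℂ A) * leg1 X * leg2 Y =
      leg2 Y * leg1 X * R.map (algebraMap ℂ A) := h
    calc leg2 S * R.map (algebraMap ℂ A) * leg1 X
        = leg2 S * (R.map (algebraMap ℂ A) * leg1 X * leg2 Y) * leg2 S := by
          simp only [mul_assoc, k2, mul_one]
      _ = (leg2 S * leg2 Y) * leg1 X * R.map (algebraMap ℂ A) * leg2 S := by
          rw [h']; simp only [mul_assoc]
      _ = _ := by rw [k1, one_mul]
  have := congrFun (congrFun key (a, b)) (c, d)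
  simp only [leg1, leg2, Matrix.mul_apply, Matrix.kroneckerMap_apply, Matrix.one_apply,
      Fintype.sum_prod_type, ite_mul, mul_ite, one_mul, zero_mul, mul_zero, mul_one,
      Matrix.map_apply, Finset.sum_ite_eq, Finset.sum_ite_eq', Finset.mem_univ, if_true,
      Finset.sum_mul, Finset.sum_const_zero, Finset.sum_ite_irrel] at this
  simp only [Fintype.sum_prod_type]
  convert this using 1
  · refine Finset.sum_congr rfl fun r _ => Finset.sum_congr rfl fun s _ => ?_
    rw [Algebra.smul_def, ← mul_assoc, Algebra.commutes]
  · rw [Finset.sum_comm]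
    refine Finset.sum_congr rfl fun r _ => Finset.sum_congr rfl fun s _ => ?_
    rw [Algebra.smul_def, ← mul_assoc, Algebra.commutes]

/-- Entries of the exchange relation between `T(z)` and an inverse `S`, same row and column. -/
lemma row_mul_inverse {q x : ℂ} {X Y S : Matrix (Fin n) (Fin n) A}
    (h : Exchange (Raff n q x) X Y) (h1 : S * Y = 1) (h2 : Y * S = 1) (e c : Fin n) :
    row q x (fun f => S c f * X f c) e = -row q⁻¹ x⁻¹ (fun g => X e g * S g e) c := by
  have := exchange_inverse h h1 h2 e c c e
  simp only [Fintype.sum_prod_type] at this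
  have hl : ∀ f g : Fin n, f ≠ g → Raff n q x (e, g) (f, e) = 0 := by
    intro f g hfg
    have : ¬ (e = f ∧ g = e) := fun h => hfg (h.1.symm.trans h.2.symm)
    simp [Raff, this, hfg.symm]
  have hr : ∀ f g : Fin n, f ≠ g → Raff n q x (f, c) (c, g) = 0 := by
    intro f g hfg
    have : ¬ (f = c ∧ c = g) := fun h => hfg (h.1.trans h.2)
    simp [Raff, this, hfg]
  rw [row, row, ← Finset.sum_neg_distrib]
  convert this using 1
  · refine Finset.sum_congr rfl fun f _ => ?_
    rw [Finset.sum_eq_single f (fun g _ hg => by rw [hl f g hg.symm, zero_smul]) (by simp),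
      Raff_swap]
  · refine Finset.sum_congr rfl fun f _ => ?_
    rw [Finset.sum_eq_single f (fun g _ hg => by rw [hr f g hg.symm, zero_smul]) (by simp),
      Raff_swap, ← neg_smul]
    congr 1
    -- Inverting both `q` and `x` changes the sign of `𝔞(x)` and of `q - q⁻¹` and swaps `x` with
    -- `x⁻¹`. So the coefficients on this side, where the order of indices is reversed, again form a
    -- row.
    by_cases hfc : f = c
    · subst hfc
      simp [afun]
      ring
    · have : c = f ↔ False := by simp [Ne.symm hfc]
      simp only [hfc, this, if_false, inv_inv]
      rcases lt_or_gt_of_ne hfc with h | h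
      · simp [h, h.not_gt]
        ring
      · simp [h, h.not_gt]
        ring

/-- For `b ≠ c` the exchange entries of `R` cannot contribute on the right, so one diagonal entry
`𝔟(x)` survives. -/
lemma row_mul_inverse_of_ne {q x : ℂ} {X Y S : Matrix (Fin n) (Fin n) A}
    (h : Exchange (Raff n q x) X Y) (h1 : S * Y = 1) (h2 : Y * S = 1) (e : Fin n)
    {b c : Fin n} (hbc : b ≠ c) :
    row q x (fun f => S b f * X f c) e = bfun x • (X e c * S b e) := by
  have := exchange_inverse h h1 h2 e b c e
  simp only [Fintype.sum_prod_type] at this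
  have hl : ∀ f g : Fin n, f ≠ g → Raff n q x (e, g) (f, e) = 0 := by
    intro f g hfg
    have : ¬ (e = f ∧ g = e) := fun h => hfg (h.1.symm.trans h.2.symm)
    simp [Raff, this, hfg.symm]
  rw [row]
  convert this using 1
  · refine Finset.sum_congr rfl fun f _ => ?_
    rw [Finset.sum_eq_single f (fun g _ hg => by rw [hl f g hg.symm, zero_smul]) (by simp),
      Raff_swap]
  · rw [Finset.sum_eq_single c, Finset.sum_eq_single b]
    · simp [Raff, hbc.symm]
    · intro g _ hg
      simp [Raff, hbc, hg.symm]
    · simp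
    · intro f _ hf
      refine Finset.sum_eq_zero fun g _ => ?_
      simp [Raff, hbc, hf]
    · simp

lemma row_apply {W : Type*} [AddCommGroup W] [Module ℂ W] (q x : ℂ)
    (X : Fin n → Module.End ℂ W) (e : Fin n) (ω : W) :
    row q x X e ω = row q x (fun f => X f ω) e := by
  simp only [row, LinearMap.sum_apply, LinearMap.smul_apply]

end Exchange

/-! ### Vector-valued Laurent polynomials and specialization. -/

section Laurent

variable {E : Type*} [AddCommGroup E] [Module ℂ E]

/-- `f` is given by a Laurent polynomial with coefficients in `E` away from the origin. -/
def IsLaurent (f : ℂ → E) : Prop :=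
  ∃ (s : Finset ℤ) (c : ℤ → E), ∀ z : ℂ, z ≠ 0 → f z = ∑ m ∈ s, z ^ m • c m

lemma IsLaurent.congr {f g : ℂ → E} (hf : IsLaurent f) (h : ∀ z, z ≠ 0 → g z = f z) :
    IsLaurent g := by
  obtain ⟨s, c, hc⟩ := hf
  exact ⟨s, c, fun z hz => (h z hz).trans (hc z hz)⟩

lemma isLaurent_zpow_smul (m : ℤ) (v : E) : IsLaurent fun z => z ^ m • v :=
  ⟨{m}, fun _ => v, fun z _ => by simp⟩

lemma isLaurent_const (v : E) : IsLaurent fun _ => v :=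
  (isLaurent_zpow_smul 0 v).congr fun z _ => by simp

lemma IsLaurent.add {f g : ℂ → E} (hf : IsLaurent f) (hg : IsLaurent g) :
    IsLaurent fun z => f z + g z := by
  classical
  obtain ⟨s, c, hc⟩ := hf
  obtain ⟨t, d, hd⟩ := hg
  refine ⟨s ∪ t, fun m => (if m ∈ s then c m else 0) + (if m ∈ t then d m else 0),
    fun z hz => ?_⟩
  beta_reduce
  rw [hc z hz, hd z hz]
  simp only [smul_add, Finset.sum_add_distrib, smul_ite, smul_zero, Finset.sum_ite_mem,
    Finset.union_inter_cancel_left, Finset.union_inter_cancel_right]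

lemma IsLaurent.sum {ι : Type*} (s : Finset ι) {f : ι → ℂ → E} (h : ∀ i ∈ s, IsLaurent (f i)) :
    IsLaurent fun z => ∑ i ∈ s, f i z := by
  classical
  induction s using Finset.induction_on with
  | empty => simpa using isLaurent_const (0 : E)
  | insert i s hi ih =>
    simp only [Finset.sum_insert hi]
    exact (h i (by simp)).add (ih fun j hj => h j (by simp [hj]))

lemma IsLaurent.map {F : Type*} [AddCommGroup F] [Module ℂ F] {f : ℂ → E} (hf : IsLaurent f)
    (φ : E →ₗ[ℂ] F) : IsLaurent fun z => φ (f z) := by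
  obtain ⟨s, c, hc⟩ := hf
  exact ⟨s, fun m => φ (c m), fun z hz => by simp [hc z hz]⟩

lemma IsLaurent.map₂ {F G : Type*} [AddCommGroup F] [Module ℂ F] [AddCommGroup G] [Module ℂ G]
    {f : ℂ → E} {g : ℂ → F} (hf : IsLaurent f) (hg : IsLaurent g) (φ : E →ₗ[ℂ] F →ₗ[ℂ] G) :
    IsLaurent fun z => φ (f z) (g z) := by
  obtain ⟨s, c, hc⟩ := hf
  obtain ⟨t, d, hd⟩ := hg
  have : IsLaurent fun z : ℂ => ∑ m ∈ s, ∑ l ∈ t, z ^ (m + l) • φ (c m) (d l) :=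
    .sum s fun m _ => .sum t fun l _ => isLaurent_zpow_smul _ _
  refine this.congr fun z hz => ?_
  rw [hc z hz, hd z hz]
  simp only [map_sum, LinearMap.sum_apply, map_smul, LinearMap.smul_apply, Finset.smul_sum,
    smul_smul, zpow_add₀ hz]
  rw [Finset.sum_comm]
  simp only [mul_comm]

lemma IsLaurent.smul {f : ℂ → ℂ} {g : ℂ → E} (hf : IsLaurent f) (hg : IsLaurent g) :
    IsLaurent fun z => f z • g z :=
  hf.map₂ hg (LinearMap.lsmul ℂ E)

lemma IsLaurent.sub {f g : ℂ → E} (hf : IsLaurent f) (hg : IsLaurent g) :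
    IsLaurent fun z => f z - g z := by
  have := hf.add (hg.map (-LinearMap.id))
  exact this.congr fun z _ => by simp [sub_eq_add_neg]

lemma IsLaurent.mul {A : Type*} [Ring A] [Algebra ℂ A] {f g : ℂ → A} (hf : IsLaurent f)
    (hg : IsLaurent g) : IsLaurent fun z => f z * g z :=
  hf.map₂ hg (LinearMap.mul ℂ A)

lemma IsLaurent.comp_mul {f : ℂ → E} (hf : IsLaurent f) {t : ℂ} (ht : t ≠ 0) :
    IsLaurent fun z => f (z * t) := by
  obtain ⟨s, c, hc⟩ := hf
  exact ⟨s, fun m => t ^ m • c m, fun z hz => by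
    simp [hc _ (mul_ne_zero hz ht), mul_zpow, smul_smul]⟩

lemma isLaurent_div (w : ℂ) : IsLaurent fun z => z / w :=
  (isLaurent_zpow_smul 1 w⁻¹).congr fun z _ => by simp [div_eq_mul_inv]

lemma isLaurent_div_inv (w : ℂ) : IsLaurent fun z => (z / w)⁻¹ :=
  (isLaurent_zpow_smul (-1) w).congr fun z _ => by simp [div_eq_mul_inv, mul_comm]

lemma IsLaurent.eq_zero_of_eventually {f : ℂ → E} (hf : IsLaurent f) {z₀ : ℂ} (hz : z₀ ≠ 0)
    (h : ∀ᶠ z in nhdsWithin z₀ {z₀}ᶜ, f z = 0) : f z₀ = 0 := by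
  obtain ⟨s, c, hc⟩ := hf
  -- `E` carries no topology, so continuity is used after pairing with linear functionals.
  rw [← Module.forall_dual_apply_eq_zero_iff ℂ]
  intro φ
  have hcont : ContinuousAt (fun z : ℂ => ∑ m ∈ s, z ^ m * φ (c m)) z₀ := by
    refine tendsto_finsetSum _ fun m _ => ?_
    exact (continuousAt_zpow₀ z₀ m (Or.inl hz)).mul continuousAt_const
  have hne : ∀ᶠ z in nhdsWithin z₀ {z₀}ᶜ, z ≠ 0 :=
    (eventually_ne_nhds hz).filter_mono nhdsWithin_le_nhds
  have h0 : (fun z : ℂ => ∑ m ∈ s, z ^ m * φ (c m)) =ᶠ[nhdsWithin z₀ {z₀}ᶜ] fun _ => 0 := by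
    filter_upwards [h, hne] with z h1 h2
    have := congrArg φ (hc z h2)
    rw [h1] at this
    simpa using this.symm
  have h1 := tendsto_nhds_unique (hcont.tendsto.mono_left nhdsWithin_le_nhds)
    (tendsto_const_nhds.congr' h0.symm)
  rw [hc z₀ hz]
  simpa using h1

lemma bfun_eq_zero_iff {x : ℂ} (hx : x ≠ 0) : bfun x = 0 ↔ x ^ 2 = 1 := by
  rw [bfun, sub_eq_zero]
  constructor
  · intro h
    rw [sq]; nth_rewrite 1 [h]; exact inv_mul_cancel₀ hx
  · intro h
    exact eq_inv_of_mul_eq_one_left (by rw [← sq, h])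

/-- The factor vanishes only at `z = ± w`, and a Laurent polynomial that is zero off finitely many
points is zero there too. -/
lemma IsLaurent.eq_zero_of_bfun_smul {f : ℂ → E} (hf : IsLaurent f) {w : ℂ} (hw : w ≠ 0)
    (h : ∀ z, z ≠ 0 → bfun (z / w) • f z = 0) {z : ℂ} (hz : z ≠ 0) : f z = 0 := by
  refine hf.eq_zero_of_eventually hz ?_
  have hfin : ({w, -w, 0} : Set ℂ).Finite := by simp
  have := (hfin.subset (Set.sdiff_subset (t := {z}))).isClosed.isOpen_compl.mem_nhds
    (show z ∈ (({w, -w, 0} : Set ℂ) \ {z})ᶜ by simp)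
  filter_upwards [nhdsWithin_le_nhds this, self_mem_nhdsWithin] with y hy hyz
  have hy' : y ∉ ({w, -w, 0} : Set ℂ) := fun h' => hy ⟨h', hyz⟩
  simp only [Set.mem_insert_iff, Set.mem_singleton_iff, not_or] at hy'
  refine (smul_eq_zero.mp (h y hy'.2.2)).resolve_left fun h0 => ?_
  rw [bfun_eq_zero_iff (div_ne_zero hy'.2.2 hw), div_pow, div_eq_one_iff_eq (pow_ne_zero 2 hw),
    sq_eq_sq_iff_eq_or_eq_neg] at h0
  exact h0.elim hy'.1 hy'.2.1

/-- Specialization at `x = q ^ (-a')` of a Laurent family on which all rows but the last one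
vanish. -/
lemma last_eq_of_row {n : ℕ} {q w : ℂ} (hq : q ≠ 0) (hq2 : q ^ 2 ≠ 1) (hw : w ≠ 0)
    {D : ℂ → Fin n → E} {Z : ℂ → E} (hD : ∀ f, IsLaurent fun z => D z f) (hZ : IsLaurent Z)
    {a a' : Fin n} (haa : (a' : ℕ) = a + 1) (hs : ∀ z, z ≠ 0 → ∀ f, a' < f → D z f = 0)
    (h0 : ∀ z, z ≠ 0 → ∀ e < a, row q (z / w) (D z) e = 0)
    (ha : ∀ z, z ≠ 0 → row q (z / w) (D z) a = -(q⁻¹ * bfun (z / w)) • Z z) :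
    D (w * q ^ (-(a' : ℤ))) a' = Z (w * q ^ (-(a' : ℤ))) := by
  -- `total_of_row` and `bfun_smul_last` both express a multiple of the total of `D z` as `bfun (z /
  -- w)` times something. Eliminating the total and removing the common factor leaves `G`.
  set G : ℂ → E := fun z => ((q - q⁻¹) * (z / w)) • (D z a' - Z z) +
    (q ^ (2 * (a' : ℕ)) * (z / w) - (z / w)⁻¹) •
      (q⁻¹ • Z z + q⁻¹ • partialSum (D z) (a + 1) - q • partialSum (D z) a) with hG
  have hP : ∀ k, IsLaurent fun z => partialSum (D z) k := fun k => .sum _ fun f _ => by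
    by_cases hf : (f : ℕ) < k
    · simpa [hf] using hD f
    · simpa [hf] using isLaurent_const (0 : E)
  have hGL : IsLaurent G := by
    refine .add (.smul (.smul (isLaurent_const _) (isLaurent_div w)) ((hD a').sub hZ))
      (.smul (.sub (.smul (isLaurent_const _) (isLaurent_div w)) (isLaurent_div_inv w)) ?_)
    exact .sub (.add (.smul (isLaurent_const _) hZ) (.smul (isLaurent_const _) (hP _)))
      (.smul (isLaurent_const _) (hP _))
  have hz0 : w * q ^ (-(a' : ℤ)) ≠ 0 := mul_ne_zero hw (zpow_ne_zero _ hq)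
  have hG0 : G (w * q ^ (-(a' : ℤ))) = 0 := by
    refine hGL.eq_zero_of_bfun_smul hw (fun z hz => ?_) hz0
    have hx : z / w ≠ 0 := div_ne_zero hz hw
    have h1 := total_of_row hq hx (D z) (Z z) (ha z hz)
    have h2 := bfun_smul_last hq hx (D z) (Z z) haa (hs z hz) (h0 z hz) (ha z hz)
    have h3 : bfun (z / w) • G z = ((q - q⁻¹) * (z / w)) • (bfun (z / w) • (D z a' - Z z)) -
        (q ^ (2 * (a' : ℕ)) * (z / w) - (z / w)⁻¹) • (-bfun (z / w) •
      (q⁻¹ • Z z + q⁻¹ • partialSum (D z) (a + 1) - q • partialSum (D z) a)) := by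
      rw [hG]; module
    rw [h3, h2, ← h1]
    module
  have hx0 : w * q ^ (-(a' : ℤ)) / w = q ^ (-(a' : ℤ)) := by field_simp
  -- The point is chosen so that this coefficient vanishes: at `x = q ^ (-a')` only the difference
  -- of the last entry and `Z` remains in `G`.
  have hc : q ^ (2 * (a' : ℕ)) * q ^ (-(a' : ℤ)) - (q ^ (-(a' : ℤ)))⁻¹ = 0 := by
    rw [zpow_neg, inv_inv, zpow_natCast]
    field_simp
    ring
  simp only [hG, hx0, hc, zero_smul, add_zero] at hG0
  have hk : (q - q⁻¹) * q ^ (-(a' : ℤ)) ≠ 0 := by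
    refine mul_ne_zero (fun h => hq2 ?_) (zpow_ne_zero _ hq)
    field_simp at h
    linear_combination h
  exact sub_eq_zero.mp ((smul_eq_zero.mp hG0).resolve_left hk)

end Laurent

/-! ### The inverse monodromy matrix on a highest weight vector. -/

section Inverse

variable {n : ℕ} {W : Type*} [AddCommGroup W] [Module ℂ W]
  {T : ℂ → Matrix (Fin n) (Fin n) (Module.End ℂ W)} {ω : W} {P : Fin n → ℂ → ℂ}

lemma isLaurent_entry_apply (hT : IsLaurent T) (a b : Fin n) (ω : W) :
    IsLaurent fun z => T z a b ω :=
  hT.map ((LinearMap.applyₗ ω).comp (Matrix.entryLinearMap ℂ (Module.End ℂ W) a b))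

lemma Phat_succ (q : ℂ) (P : Fin n → ℂ → ℂ) {a a' : Fin n} (haa : (a' : ℕ) = a + 1) (z : ℂ) :
    Phat q P a' z =
      Phat q P a z * (P a (z * q ^ (-(a' : ℤ))) / P a' (z * q ^ (-(a' : ℤ)))) := by
  have h : Finset.univ.filter (fun c : Fin n => c < a') =
      insert a (Finset.univ.filter fun c : Fin n => c < a) := by
    ext c
    simp only [Finset.mem_filter, Finset.mem_univ, true_and, Finset.mem_insert, Fin.lt_def,
      Fin.ext_iff]
    omega
  have h2 : (a' : ℤ) = (a : ℤ) + 1 := by omega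
  rw [Phat, Phat, h, Finset.prod_insert (by simp), ← h2]
  ring

/-- The inverse monodromy matrix at `w` applied to a highest weight vector: it is again upper
triangular, with diagonal entries `P̂_a(w)`. -/
lemma inverse_apply {q : ℂ} (hq : q ≠ 0) (hq2 : q ^ 2 ≠ 1) (hT : IsLaurent T)
    (hex : ∀ z w : ℂ, z ≠ 0 → w ≠ 0 → Exchange (Raff n q (z / w)) (T z) (T w))
    (hω : IsHighestWeight T ω P) {w : ℂ} (hw : w ≠ 0)
    (hP : ∀ a : Fin n, P a (w * q ^ (-(a : ℤ))) ≠ 0)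
    {S : Matrix (Fin n) (Fin n) (Module.End ℂ W)} (h1 : S * T w = 1) (h2 : T w * S = 1)
    (k : Fin n) :
    (∀ b, k < b → S b k ω = 0) ∧ S k k ω = Phat q P k w • ω := by
  obtain ⟨k, hk⟩ := k
  induction k using Nat.strong_induction_on with
  | _ k ih =>
  rcases k with _ | k
  · set o : Fin n := ⟨0, hk⟩
    -- Only the diagonal entry of column `0` of `T w` survives on `ω`, so `S * T w = 1` determines
    -- column `0` of `S`.
    have key : ∀ b, P o w • S b o ω = (1 : Matrix (Fin n) (Fin n) (Module.End ℂ W)) b o ω := by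
      intro b
      rw [← h1, Matrix.mul_apply, LinearMap.sum_apply, Finset.sum_eq_single o]
      · rw [Module.End.mul_apply, hω.diag w hw, map_smul]
      · intro c _ hc
        have : o < c := Nat.pos_of_ne_zero fun h => hc (Fin.ext h)
        rw [Module.End.mul_apply, hω.lower w hw _ _ this, map_zero]
      · simp
    have hP0 : P o w ≠ 0 := by simpa [o] using hP o
    refine ⟨fun b hb => ?_, ?_⟩
    · have := key b
      rw [Matrix.one_apply_ne hb.ne', LinearMap.zero_apply] at this
      exact (smul_eq_zero.mp this).resolve_left hP0
    · have h := key o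
      rw [Matrix.one_apply_eq, Module.End.one_apply] at h
      have hph : Phat q P o w = (P o w)⁻¹ := by
        have : Finset.univ.filter (fun c : Fin n => c < o) = ∅ := by
          ext c; simp [o, Fin.lt_def]
        simp [Phat, this, o]
      rw [hph]
      nth_rewrite 2 [← h]
      rw [smul_smul, inv_mul_cancel₀ hP0, one_smul]
  · set a : Fin n := ⟨k, by omega⟩ with ha
    set a' : Fin n := ⟨k + 1, hk⟩ with ha'
    have haa : (a' : ℕ) = a + 1 := rfl
    have hlt : a < a' := by simp [a, a']
    have hS : ∀ e ≤ a, ∀ b, e < b → S b e ω = 0 := fun e he =>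
      (ih e (Nat.lt_succ_of_le he) e.2).1
    have hSa : S a a ω = Phat q P a w • ω := (ih k (Nat.lt_succ_self k) a.2).2
    have hrow := fun (z : ℂ) (hz : z ≠ 0) (e c : Fin n) => congrArg (fun f => f ω)
      (row_mul_inverse (hex z w hz hw) h1 h2 e c)
    have hrow' := fun (z : ℂ) (hz : z ≠ 0) (e : Fin n) (b c : Fin n) (hbc : b ≠ c) =>
      congrArg (fun f => f ω) (row_mul_inverse_of_ne (hex z w hz hw) h1 h2 e hbc)
    simp only [row_apply, LinearMap.neg_apply, LinearMap.smul_apply, Module.End.mul_apply]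
      at hrow hrow'
    have hD : ∀ b c f, IsLaurent fun z => S b f (T z f c ω) := fun b c f =>
      (isLaurent_entry_apply hT f c ω).map (S b f)
    have hz0 : w * q ^ (-(a' : ℤ)) ≠ 0 := mul_ne_zero hw (zpow_ne_zero _ hq)
    have hsupp : ∀ z, z ≠ 0 → ∀ b c f, c < f → S b f (T z f c ω) = 0 := fun z hz b c f hf => by
      rw [hω.lower z hz _ _ hf, map_zero]
    refine ⟨fun b hb => ?_, ?_⟩
    -- Off the diagonal, the rows up to `a` equal `𝔟 • T z e a' (S b e ω)`, which vanish by
    -- induction. The last entry at the special point is `P a'` times `S b a' ω`.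
    · have := last_eq_of_row (D := fun z f => S b f (T z f a' ω)) (Z := fun _ => 0) hq hq2 hw
        (hD b a') (isLaurent_const _) haa (fun z hz f hf => hsupp z hz b a' f hf)
        (fun z hz e he => by
          rw [hrow' z hz e b a' hb.ne', hS e he.le b ((he.trans hlt).trans hb)]; simp)
        (fun z hz => by
          rw [hrow' z hz a b a' hb.ne', hS a le_rfl b (hlt.trans hb)]; simp)
      simp only [hω.diag _ hz0, map_smul] at this
      exact (smul_eq_zero.mp this).resolve_left (hP a')
    · set Y : ℂ → Fin n → W := fun z e => ∑ f, T z e f (S f e ω) with hY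
      -- The right-hand side does not depend on `c`, so these rows cancel in the difference of the
      -- families for `a'` and `a`. Row `a` of the family for `a` has an extra diagonal term, which
      -- becomes `Z`.
      have hr : ∀ z, z ≠ 0 → ∀ e c, e < c → e ≤ a →
          row q (z / w) (fun f => S c f (T z f c ω)) e = ((q - q⁻¹) * (z / w)) • Y z e := by
        intro z hz e c hec hea
        rw [hrow z hz e c, row_of_support_lt _ _ _ hec, inv_inv, inv_inv, ← neg_smul]
        · congr 1; ring
        · intro f hf
          rw [hS e hea f hf, map_zero]
      have hra : ∀ z, z ≠ 0 → row q (z / w) (fun f => S a f (T z f a ω)) a =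
          ((q - q⁻¹) * (z / w)) • Y z a + (q⁻¹ * bfun (z / w)) • T z a a (S a a ω) := by
        intro z hz
        rw [hrow z hz a a, row_of_support_le (inv_ne_zero hq) (inv_ne_zero (div_ne_zero hz hw)),
          inv_inv, inv_inv, bfun_inv]
        · simp only [hY]; module
        · intro f hf
          rw [hS a le_rfl f hf, map_zero]
      have := last_eq_of_row
        (D := fun z => (fun f => S a' f (T z f a' ω)) - fun f => S a f (T z f a ω))
        (Z := fun z => T z a a (S a a ω)) hq hq2 hw
        (fun f => (hD a' a' f).sub (hD a a f)) (isLaurent_entry_apply hT a a _) haa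
        (fun z hz f hf => by simp [hsupp z hz a' a' f hf, hsupp z hz a a f (hlt.trans hf)])
        (fun z hz e he => by
          rw [row_sub, hr z hz e a' (he.trans hlt) he.le, hr z hz e a he he.le, sub_self])
        (fun z hz => by
          rw [row_sub, hr z hz a a' hlt le_rfl, hra z hz]; module)
      simp only [Pi.sub_apply, hω.diag _ hz0, hω.lower _ hz0 _ _ hlt, map_smul, map_zero, sub_zero,
        hSa] at this
      rw [Phat_succ q P haa, mul_div_assoc', div_eq_inv_mul, mul_smul, mul_smul, ← this, smul_smul,
        inv_mul_cancel₀ (hP a'), one_smul]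

end Inverse

/-! ### Scalar identities for the boundary coefficients. -/

section Scalar

variable {n : ℕ}

lemma bfun_eq_div {x : ℂ} (hx : x ≠ 0) : bfun x = (x ^ 2 - 1) / x := by
  rw [bfun]; field_simp

/-- The coefficient of a highest weight vector in the diagonal entry `ℬ_ee(z)` applied to it, with
`p_j = P_j(z) P̂_j(z⁻¹)`. -/
noncomputable def reflWeight (q : ℂ) (M : ℕ) (ξ z : ℂ) (p : Fin n → ℂ) (e : Fin n) : ℂ :=
  Gam q M ξ e z * p e + (q - q⁻¹) * (z ^ 2)⁻¹ *
    ∑ j, if j < e then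
      Gam q M ξ j z * q ^ (-(j : ℤ)) / bfun (q ^ ((j : ℕ) + 1) * z ^ 2) * p j else 0

lemma reflWeight_succ (q : ℂ) (M : ℕ) (ξ z : ℂ) (p : Fin n → ℂ) {e e' : Fin n}
    (hee : (e' : ℕ) = e + 1) :
    reflWeight q M ξ z p e' = reflWeight q M ξ z p e + Gam q M ξ e' z * p e' - Gam q M ξ e z * p e +
      (q - q⁻¹) * (z ^ 2)⁻¹ *
        (Gam q M ξ e z * q ^ (-(e : ℤ)) / bfun (q ^ (e' : ℕ) * z ^ 2) * p e) := by
  have h : ∀ F : Fin n → ℂ, (∑ j, if j < e' then F j else 0) =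
      (∑ j, if j < e then F j else 0) + F e := by
    intro F
    have : F e = ∑ j, if j = e then F j else 0 := by simp
    rw [this, ← Finset.sum_add_distrib]
    refine Finset.sum_congr rfl fun j _ => ?_
    by_cases h : j = e
    · subst h
      simp [Fin.lt_def, hee]
    · have h0 : (j : ℕ) ≠ e := fun h' => h (Fin.ext h')
      have : j < e' ↔ j < e := by rw [Fin.lt_def, Fin.lt_def]; omega
      simp [h, this]
  rw [reflWeight, reflWeight, h, hee]
  ring

lemma zpow_mul_beta {q : ℂ} (hq : q ≠ 0) (M : ℕ) (ξ z : ℂ) :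
    q ^ (-2 * (M : ℤ)) * beta ξ (z * q ^ M) = (q ^ (2 * M))⁻¹ - ξ ^ 2 * z ^ 2 := by
  have : q ^ (-2 * (M : ℤ)) = (q ^ (2 * M))⁻¹ := by
    rw [neg_mul, zpow_neg]; norm_cast
  rw [this, beta, pow_mul' q 2 M]
  field_simp

/-- The scalar content of the step from `ℬ_ee(z)` to `ℬ_{e+1,e+1}(z)`. -/
lemma reflWeight_step {q : ℂ} (hq : q ≠ 0) (M : ℕ) (ξ : ℂ) {z : ℂ} (hz : z ≠ 0) (p : Fin n → ℂ)
    {e e' : Fin n} (hee : (e' : ℕ) = e + 1)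
    (hb0 : bfun (z ^ 2) ≠ 0) (hbe : bfun (q ^ (e : ℕ) * z ^ 2) ≠ 0)
    (hbe' : bfun (q ^ (e' : ℕ) * z ^ 2) ≠ 0) :
    reflWeight q M ξ z p e' = reflWeight q M ξ z p e +
      (if M ≤ e then (q ^ (2 * M))⁻¹ - ξ ^ 2 * z ^ 2 else alpha ξ z) *
        (bfun (z ^ 2) * (p e' - p e) / (z ^ 2 - (q ^ (2 * (e' : ℕ)))⁻¹ * (z ^ 2)⁻¹)) -
      (if M = e' then (z ^ 2 * bfun (z ^ 2)) * p e' else 0) := by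
  have hzz : z ^ 2 ≠ 0 := pow_ne_zero 2 hz
  have hQ : q ^ (e : ℕ) ≠ 0 := pow_ne_zero _ hq
  have hden : z ^ 2 - (q ^ (2 * (e' : ℕ)))⁻¹ * (z ^ 2)⁻¹ =
      (q ^ (e' : ℕ))⁻¹ * bfun (q ^ (e' : ℕ) * z ^ 2) := by
    rw [bfun, pow_mul' q 2 (e' : ℕ)]
    field_simp
  rw [reflWeight_succ q M ξ z p hee, hden, Gam, Gam, zpow_mul_beta hq, zpow_neg, zpow_natCast]
  rw [bfun_eq_div (mul_ne_zero hQ hzz)] at hbe ⊢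
  rw [bfun_eq_div (mul_ne_zero (pow_ne_zero _ hq) hzz)] at hbe' ⊢
  rw [bfun_eq_div hzz] at hb0 ⊢
  have n1 := (div_ne_zero_iff.mp hbe).1
  have n2 := (div_ne_zero_iff.mp hbe').1
  have n3 := (div_ne_zero_iff.mp hb0).1
  rw [hee, pow_succ q] at n2 ⊢
  obtain ⟨d₁, hd₁⟩ : ∃ d, d = (q ^ (e : ℕ) * z ^ 2) ^ 2 - 1 := ⟨_, rfl⟩
  obtain ⟨d₂, hd₂⟩ : ∃ d, d = (q ^ (e : ℕ) * q * z ^ 2) ^ 2 - 1 := ⟨_, rfl⟩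
  rw [← hd₁] at n1 ⊢
  rw [← hd₂] at n2 ⊢
  rcases lt_trichotomy M ((e : ℕ) + 1) with h | h | h
  · have h1 : ¬ (e : ℕ) < M := by omega
    have h2 : ¬ (e : ℕ) + 1 < M := by omega
    have h3 : M ≤ (e : ℕ) := by omega
    simp only [h1, h2, h3, h.ne, if_true, if_false]
    generalize (q ^ (2 * M))⁻¹ = r
    generalize q ^ (e : ℕ) = Q at *
    field_simp
    rw [hd₁, hd₂]
    ring
  · have hM : (q ^ (2 * M))⁻¹ = ((q ^ (e : ℕ)) ^ 2)⁻¹ * (q ^ 2)⁻¹ := by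
      rw [h, ← mul_inv]; ring
    have h1 : (e : ℕ) < M := by omega
    have h2 : ¬ (e : ℕ) + 1 < M := by omega
    have h3 : ¬ M ≤ (e : ℕ) := by omega
    rw [hM]
    simp only [h1, h2, h3, if_pos h, if_true, if_false, alpha]
    clear hM
    generalize q ^ (e : ℕ) = Q at *
    field_simp
    rw [hd₁, hd₂]
    ring
  · have h1 : (e : ℕ) < M := by omega
    have h2 : (e : ℕ) + 1 < M := by omega
    have h3 : ¬ M ≤ (e : ℕ) := by omega
    simp only [h1, h2, h3, h.ne', if_true, if_false]
    generalize alpha ξ z = r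
    generalize q ^ (e : ℕ) = Q at *
    field_simp
    rw [hd₁, hd₂]
    ring

lemma sum_tail {f : Fin n → ℂ} {τ : ℕ → ℂ} (h : ∀ e : Fin n, f e = τ e - τ (e + 1)) {k : ℕ}
    (hk : k ≤ n) : (∑ e : Fin n, if k ≤ (e : ℕ) then f e else 0) = τ k - τ n := by
  have h1 : (∑ e : Fin n, if k ≤ (e : ℕ) then f e else 0) =
      ∑ e ∈ Finset.range n, if k ≤ e then τ e - τ (e + 1) else 0 := by
    rw [← Fin.sum_univ_eq_sum_range (fun e => if k ≤ e then τ e - τ (e + 1) else 0) n]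
    exact Finset.sum_congr rfl fun e _ => by rw [h e]
  rw [h1]
  clear h1 h f
  induction n, hk using Nat.le_induction with
  | base =>
    rw [sub_self]
    exact Finset.sum_eq_zero fun e he => by simp [Finset.mem_range.mp he]
  | succ m hm ih =>
    rw [Finset.sum_range_succ, if_pos hm, ih]
    ring

/-- Tails of the trace of `K⁺(z)`. -/
lemma sum_Kplus_tail {q : ℂ} (hq : q ≠ 0) {Mp : ℕ} (hMp : Mp ≤ n) (ξp z : ℂ) (j : Fin n) :
    (q - q⁻¹) * (∑ e : Fin n, if j < e then Kplus q Mp ξp z e else 0) =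
      if (j : ℕ) < Mp then
        alphaT n q ξp z * (q ^ n * ((q ^ ((j : ℕ) + 1)) ^ 2)⁻¹ - q ^ n * ((q ^ Mp) ^ 2)⁻¹) +
          betaT n q ξp z * (q ^ n * ((q ^ Mp) ^ 2)⁻¹ - (q ^ n)⁻¹)
      else betaT n q ξp z * (q ^ n * ((q ^ ((j : ℕ) + 1)) ^ 2)⁻¹ - (q ^ n)⁻¹) := by
  -- A discrete antiderivative of the geometric sequence `(q - q⁻¹) * Kplus`, with constants chosen
  -- so that the two branches agree at `Mp` and `τ n = 0`.
  set τ : ℕ → ℂ := fun k => if k ≤ Mp then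
        alphaT n q ξp z * (q ^ n * ((q ^ k) ^ 2)⁻¹ - q ^ n * ((q ^ Mp) ^ 2)⁻¹) +
          betaT n q ξp z * (q ^ n * ((q ^ Mp) ^ 2)⁻¹ - (q ^ n)⁻¹)
      else betaT n q ξp z * (q ^ n * ((q ^ k) ^ 2)⁻¹ - (q ^ n)⁻¹) with hτ
  have hK : ∀ e : Fin n, (q - q⁻¹) * Kplus q Mp ξp z e = τ e - τ (e + 1) := by
    intro e
    have h0 : q ^ (-2 * ((e : ℤ) + 1)) = ((q ^ (e : ℕ)) ^ 2)⁻¹ * (q ^ 2)⁻¹ := by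
      rw [← mul_inv, neg_mul, zpow_neg, inv_inj]
      norm_cast
      ring
    rw [Kplus, h0, hτ]
    rcases lt_trichotomy (e : ℕ) Mp with h | h | h
    · have h1 : (e : ℕ) ≤ Mp := h.le
      have h2 : (e : ℕ) + 1 ≤ Mp := h
      simp only [h, h1, h2, if_true]
      field_simp
      ring
    · have h2 : ¬ (e : ℕ) + 1 ≤ Mp := by omega
      simp only [← h, lt_irrefl, le_refl, if_true, if_false] at h2 ⊢
      simp only [h2, if_false]
      field_simp
      ring
    · have h1 : ¬ (e : ℕ) < Mp := by omega
      have h2 : ¬ (e : ℕ) ≤ Mp := by omega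
      have h3 : ¬ (e : ℕ) + 1 ≤ Mp := by omega
      simp only [h1, h2, h3, if_false]
      field_simp
      ring
  have := sum_tail hK (k := j + 1) j.2
  have hn : τ n = 0 := by
    rw [hτ]
    rcases hMp.eq_or_lt with h | h
    · simp only [h, le_refl, if_true]
      field_simp
      ring
    · have h1 : ¬ n ≤ Mp := by omega
      simp only [h1, if_false]
      field_simp
      ring
  rw [hn, sub_zero] at this
  rw [Finset.mul_sum]
  refine Eq.trans (Finset.sum_congr rfl fun e _ => ?_) (this.trans ?_)
  · by_cases h : j < e
    · have : (j : ℕ) + 1 ≤ e := h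
      simp [h, this]
    · have : ¬ (j : ℕ) + 1 ≤ e := h
      simp [h, this]
  · rfl

/-- Exchanging the two sums, the coefficient of `Gam j * p j` is the `j`-th entry of `K⁺` plus a
multiple of the tail beyond `j`. With the tail in closed form, this coefficient factors as in
`gfun`. -/
lemma sum_Kplus_mul_reflWeight {q : ℂ} (hq : q ≠ 0) (M : ℕ) {Mp : ℕ} (hMp : Mp ≤ n) (ξ ξp : ℂ)
    {z : ℂ} (hz : z ≠ 0) (hb : ∀ k : ℕ, k ≤ n → bfun (q ^ k * z ^ 2) ≠ 0) (p : Fin n → ℂ) :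
    ∑ e, Kplus q Mp ξp z e * reflWeight q M ξ z p e = ∑ j, gfun q M Mp ξ ξp j z * p j := by
  have hzz : z ^ 2 ≠ 0 := pow_ne_zero 2 hz
  have h1 : ∑ e, Kplus q Mp ξp z e * reflWeight q M ξ z p e =
      ∑ j, Gam q M ξ j z * p j * (Kplus q Mp ξp z j + (z ^ 2)⁻¹ * q ^ (-(j : ℤ)) /
        bfun (q ^ ((j : ℕ) + 1) * z ^ 2) *
          ((q - q⁻¹) * ∑ e, if j < e then Kplus q Mp ξp z e else 0)) := by
    simp only [reflWeight, mul_add, Finset.sum_add_distrib, Finset.mul_sum]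
    congr 1
    · exact Finset.sum_congr rfl fun e _ => by ring
    · rw [Finset.sum_comm]
      refine Finset.sum_congr rfl fun j _ => Finset.sum_congr rfl fun e _ => ?_
      split_ifs <;> ring
  rw [h1]
  refine Finset.sum_congr rfl fun j _ => ?_
  have hbj := hb (j + 1) j.2
  have hj : q ^ (-(j : ℤ)) = (q ^ (j : ℕ))⁻¹ := by rw [zpow_neg, zpow_natCast]
  have h0 : q ^ (-2 * ((j : ℤ) + 1)) = ((q ^ (j : ℕ)) ^ 2)⁻¹ * (q ^ 2)⁻¹ := by
    rw [← mul_inv, neg_mul, zpow_neg, inv_inj]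
    norm_cast
    ring
  have h2 : q ^ (2 * (n : ℤ) - 2 * (Mp : ℤ)) = (q ^ n) ^ 2 * ((q ^ Mp) ^ 2)⁻¹ := by
    rw [zpow_sub₀ hq, div_eq_mul_inv]
    norm_cast
    ring
  have h3 : q ^ ((Mp : ℤ) - (n : ℤ)) = q ^ Mp * (q ^ n)⁻¹ := by
    rw [zpow_sub₀ hq, div_eq_mul_inv]
    norm_cast
  have hg : Kplus q Mp ξp z j + (z ^ 2)⁻¹ * q ^ (-(j : ℤ)) /
        bfun (q ^ ((j : ℕ) + 1) * z ^ 2) *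
          ((q - q⁻¹) * ∑ e, if j < e then Kplus q Mp ξp z e else 0) =
      q ^ (-(j : ℤ)) * (bfun (q ^ n * z ^ 2) / bfun (q ^ ((j : ℕ) + 1) * z ^ 2)) *
    (if (j : ℕ) < Mp then
      q ^ (2 * (n : ℤ) - 2 * (Mp : ℤ)) * alphaT n q ξp (z * q ^ ((Mp : ℤ) - (n : ℤ)))
    else betaT n q ξp z) := by
    rw [sum_Kplus_tail hq hMp, Kplus, hj, h0, h2, h3, alphaT, alphaT, betaT]
    have hbn : bfun (q ^ n * z ^ 2) = ((q ^ n * z ^ 2) ^ 2 - 1) / (q ^ n * z ^ 2) :=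
      bfun_eq_div (mul_ne_zero (pow_ne_zero _ hq) hzz)
    rw [bfun_eq_div (mul_ne_zero (pow_ne_zero _ hq) hzz)] at hbj ⊢
    rw [hbn]
    have n1 := (div_ne_zero_iff.mp hbj).1
    have hQn : q ^ n ≠ 0 := pow_ne_zero _ hq
    have hQM : q ^ Mp ≠ 0 := pow_ne_zero _ hq
    have hQj : q ^ (j : ℕ) ≠ 0 := pow_ne_zero _ hq
    rw [pow_succ q j] at n1 ⊢
    rw [pow_succ q n]
    obtain ⟨d, hd⟩ : ∃ d, d = (q ^ (j : ℕ) * q * z ^ 2) ^ 2 - 1 := ⟨_, rfl⟩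
    rw [← hd] at n1 ⊢
    generalize q ^ n = A at *
    generalize q ^ Mp = B at *
    generalize q ^ (j : ℕ) = C at *
    split_ifs
    · field_simp
      rw [hd]
      ring
    · field_simp
      rw [hd]
      ring
  rw [hg, gfun]
  ring

end Scalar

/-! ### Diagonal entries of the reflection monodromy matrix and their trace. -/

section Reflection

variable {n : ℕ} {W : Type*} [AddCommGroup W] [Module ℂ W]
  {T : ℂ → Matrix (Fin n) (Fin n) (Module.End ℂ W)} {ω : W} {P : Fin n → ℂ → ℂ}

lemma mul_scalarDiag_mul_apply (X S : Matrix (Fin n) (Fin n) (Module.End ℂ W)) (k : Fin n → ℂ)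
    (a b : Fin n) (ω : W) :
    (X * scalarDiag W k * S) a b ω = ∑ f, k f • X a f (S f b ω) := by
  rw [Matrix.mul_apply, LinearMap.sum_apply]
  refine Finset.sum_congr rfl fun f _ => ?_
  rw [scalarDiag, Matrix.mul_diagonal, Module.End.mul_apply, Module.End.mul_apply,
    Module.algebraMap_end_apply, map_smul]

lemma trace_scalarDiag_mul_apply (X : Matrix (Fin n) (Fin n) (Module.End ℂ W)) (k : Fin n → ℂ)
    (ω : W) : Matrix.trace (scalarDiag W k * X) ω = ∑ e, k e • X e e ω := by
  rw [Matrix.trace, LinearMap.sum_apply]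
  refine Finset.sum_congr rfl fun f _ => ?_
  rw [Matrix.diag_apply, scalarDiag, Matrix.diagonal_mul, Module.End.mul_apply,
    Module.algebraMap_end_apply]

lemma sum_Kdiag_smul (M : ℕ) (ξ z : ℂ) (X : Fin n → W) :
    ∑ f, Kdiag M ξ z f • X f =
      beta ξ z • ∑ f, X f + (alpha ξ z - beta ξ z) • partialSum X M := by
  rw [partialSum, Finset.smul_sum, Finset.smul_sum, ← Finset.sum_add_distrib]
  refine Finset.sum_congr rfl fun f _ => ?_
  rw [Kdiag]
  split_ifs
  · module
  · simp

/-- The jump of `K` carries exactly the factor `bfun (z ^ 2)` that multiplies partial sums in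
`bfun_smul_partialSum`. -/
lemma alpha_sub_beta {z : ℂ} (hz : z ≠ 0) (ξ : ℂ) :
    alpha ξ z - beta ξ z = z ^ 2 * bfun (z ^ 2) := by
  rw [alpha, beta, bfun]
  field_simp
  ring

/-- The diagonal entries of the reflection monodromy matrix on a highest weight vector. -/
lemma reflMonodromy_apply {q : ℂ} (hq : q ≠ 0) (hq2 : q ^ 2 ≠ 1) (M : ℕ) (ξ : ℂ)
    (hT : IsLaurent T)
    (hex : ∀ z w : ℂ, z ≠ 0 → w ≠ 0 → Exchange (Raff n q (z / w)) (T z) (T w))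
    (hω : IsHighestWeight T ω P) {z : ℂ} (hz : Regular q T P z) (e : Fin n) :
    reflMonodromy M ξ T z e e ω =
      reflWeight q M ξ z (fun j => P j z * Phat q P j z⁻¹) e • ω := by
  obtain ⟨hz0, hu, hb, hw⟩ := hz
  set S := Ring.inverse (T z⁻¹) with hSdef
  have h1 : S * T z⁻¹ = 1 := Ring.inverse_mul_cancel _ hu
  have h2 : T z⁻¹ * S = 1 := Ring.mul_inverse_cancel _ hu
  have hinv := inverse_apply hq hq2 hT hex hω (inv_ne_zero hz0) hw h1 h2
  set p : Fin n → ℂ := fun j => P j z * Phat q P j z⁻¹ with hp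
  have hx : z ^ 2 ≠ 0 := pow_ne_zero 2 hz0
  have hzz : z / z⁻¹ = z ^ 2 := by field_simp
  have hexz := hex z z⁻¹ hz0 (inv_ne_zero hz0)
  rw [hzz] at hexz
  have hrow := fun (e c : Fin n) => congrArg (fun f => f ω) (row_mul_inverse hexz h1 h2 e c)
  simp only [row_apply, LinearMap.neg_apply, Module.End.mul_apply] at hrow
  have hX : ∀ c f, c < f → S c f (T z f c ω) = 0 := fun c f hf => by
    rw [hω.lower z hz0 _ _ hf, map_zero]
  have hY : ∀ c f, c < f → T z c f (S f c ω) = 0 := fun c f hf => by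
    rw [(hinv c).1 f hf, map_zero]
  have hXd : ∀ c, S c c (T z c c ω) = p c • ω := fun c => by
    rw [hω.diag z hz0, map_smul, (hinv c).2, smul_smul]
  have hYd : ∀ c, T z c c (S c c ω) = p c • ω := fun c => by
    rw [(hinv c).2, map_smul, hω.diag z hz0, smul_smul, mul_comm]
  have hb0 : bfun (z ^ 2) ≠ 0 := by simpa using hb 0 (Nat.zero_le n)
  rw [reflMonodromy, mul_scalarDiag_mul_apply]
  obtain ⟨e, he⟩ := e
  induction e with
  | zero =>
    set o : Fin n := ⟨0, he⟩
    rw [Finset.sum_eq_single o, hYd, smul_smul]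
    · congr 1
      have : (∑ j, if j < o then
        Gam q M ξ j z * q ^ (-(j : ℤ)) / bfun (q ^ ((j : ℕ) + 1) * z ^ 2) * p j else 0) = 0 :=
        Finset.sum_eq_zero fun j _ => by simp [o, Fin.lt_def]
      rw [reflWeight, this, mul_zero, add_zero, Gam, Kdiag]
      congr 1
      have ho : (o : ℕ) = 0 := rfl
      rw [ho, pow_zero, one_mul, one_mul, div_self hb0, one_mul]
      split_ifs with hM
      · rfl
      -- With no `α` entries, the power of `q` and the shift in `Gam` are trivial.
      · obtain rfl : M = 0 := by omega
        simp
    · intro f _ hf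
      have : o < f := Nat.pos_of_ne_zero fun h => hf (Fin.ext h)
      rw [hY o f this, smul_zero]
    · simp
  | succ e ih =>
    set c : Fin n := ⟨e, by omega⟩
    set c' : Fin n := ⟨e + 1, he⟩
    have hcc : (c' : ℕ) = c + 1 := rfl
    have hlt : c < c' := by simp [c, c']
    have ih' := ih (by omega)
    -- By the exchange relation, row `f` of the family for index `d > f` depends on `f` alone. The
    -- rows of `D` before `c` therefore vanish, and row `c` keeps only the diagonal term. The row
    -- equations have parameters `q⁻¹` and `(z ^ 2)⁻¹`.
    set D : Fin n → W := (fun f => T z c' f (S f c' ω)) - fun f => T z c f (S f c ω) with hD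
    have hr : ∀ f d, f < d → row q⁻¹ (z ^ 2)⁻¹ (fun g => T z d g (S g d ω)) f =
        -(((q - q⁻¹) * (z ^ 2)⁻¹) • ∑ g, S f g (T z g f ω)) := by
      intro f d hf
      rw [← neg_eq_iff_eq_neg, ← hrow d f, row_of_support_lt _ _ _ hf fun g hg => hX f g hg]
    have hrc : row q⁻¹ (z ^ 2)⁻¹ (fun g => T z c g (S g c ω)) c =
        -(((q - q⁻¹) * (z ^ 2)⁻¹) • ∑ g, S c g (T z g c ω) + (q * bfun (z ^ 2)) • p c • ω) := by
      rw [← neg_eq_iff_eq_neg, ← hrow c c, row_of_support_le hq hx _ fun g hg => hX c g hg, hXd]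
    have hD0 : ∀ f < c, row q⁻¹ (z ^ 2)⁻¹ D f = 0 := fun f hf => by
      rw [hD, row_sub, hr f c' (hf.trans hlt), hr f c hf, sub_self]
    have hDc : row q⁻¹ (z ^ 2)⁻¹ D c = -(q⁻¹⁻¹ * bfun (z ^ 2)⁻¹) • p c • ω := by
      rw [hD, row_sub, hr c c' hlt, hrc, bfun_inv, inv_inv]
      module
    have hDs : ∀ f, c' < f → D f = 0 := fun f hf => by
      simp [hD, hY c' f hf, hY c f (hlt.trans hf)]
    have hDl : D c' = p c' • ω := by simp [hD, hYd, hY c c' hlt]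
    have hlast := bfun_smul_last (inv_ne_zero hq) (inv_ne_zero hx) D (p c • ω) hcc hDs hD0 hDc
    have hpart := fun k hk =>
      bfun_smul_partialSum (inv_ne_zero hq) (inv_ne_zero hx) D hD0 (k := k) hk
    have hbc' : bfun (q ^ (c' : ℕ) * z ^ 2) ≠ 0 := hb _ c'.2.le
    set d : ℂ := z ^ 2 - (q ^ (2 * (c' : ℕ)))⁻¹ * (z ^ 2)⁻¹ with hd
    have hd0 : d ≠ 0 := by
      have : d = (q ^ (c' : ℕ))⁻¹ * bfun (q ^ (c' : ℕ) * z ^ 2) := by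
        rw [hd, bfun, pow_mul' q 2 (c' : ℕ)]
        field_simp
      rw [this]
      exact mul_ne_zero (inv_ne_zero (pow_ne_zero _ hq)) hbc'
    -- Here the relation for the last entry is read backwards: that entry is known to be `p c' • ω`,
    -- which determines the total.
    have htot : ∑ f, D f = (bfun (z ^ 2) * (p c' - p c) / d) • ω := by
      rw [hDl, bfun_inv, inv_inv, inv_pow] at hlast
      have : d • ∑ f, D f = (bfun (z ^ 2) * (p c' - p c)) • ω := by
        rw [hd]
        calc _ = -(((q ^ (2 * (c' : ℕ)))⁻¹ * (z ^ 2)⁻¹ - z ^ 2) • ∑ f, D f) := by module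
          _ = _ := by rw [← hlast]; module
      rw [div_eq_inv_mul, mul_smul, ← this, smul_smul, inv_mul_cancel₀ hd0, one_smul]
    have hdiff : ∑ f, Kdiag M ξ z f • T z c' f (S f c' ω) =
        ∑ f, Kdiag M ξ z f • T z c f (S f c ω) + ∑ f, Kdiag M ξ z f • D f := by
      rw [← Finset.sum_add_distrib]
      exact Finset.sum_congr rfl fun f _ => by simp [hD, smul_sub]
    rw [hdiff, ih', sum_Kdiag_smul,
      reflWeight_step hq M ξ hz0 p hcc hb0 (hb _ c.2.le) hbc', ← hd]
    set G := bfun (z ^ 2) * (p c' - p c) / d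
    -- The partial sum up to the jump of `K` comes from the recursion if `M ≤ c`, misses only the
    -- last entry if `M = c'`, and is the total beyond that.
    rcases lt_trichotomy M (c' : ℕ) with h | h | h
    · have hMc : M ≤ (c : ℕ) := by omega
      have h3 : (alpha ξ z - beta ξ z) • partialSum D M =
          ((q ^ (2 * M))⁻¹ - 1) • ∑ f, D f := by
        have := hpart M hMc
        rw [bfun_inv, inv_pow] at this
        rw [alpha_sub_beta hz0]
        calc _ = -(z ^ 2) • (-bfun (z ^ 2) • partialSum D M) := by module
          _ = _ := by
            rw [this, smul_smul]
            congr 1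
            field_simp
      rw [if_pos hMc, if_neg h.ne, h3, htot, beta]
      module
    · have hMc : ¬ M ≤ (c : ℕ) := by omega
      have h3 : partialSum D M = ∑ f, D f - D c' := by
        rw [← partialSum_eq_sum D (k := c' + 1) fun f hf => hDs f hf, partialSum_succ D c', h,
          add_sub_cancel_right]
      rw [if_neg hMc, if_pos h, h3, hDl, htot, ← alpha_sub_beta hz0 ξ]
      module
    · have hMc : ¬ M ≤ (c : ℕ) := by omega
      have h3 : partialSum D M = ∑ f, D f :=
        partialSum_eq_sum D fun f hf => hDs f (Fin.lt_def.2 (lt_of_lt_of_le h hf))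
      rw [if_neg hMc, if_neg h.ne', h3, htot]
      module

/-- A highest weight vector of the monodromy matrix is an eigenvector of the open-chain transfer
matrix. -/
theorem transfer_hasEigenvector {q : ℂ} (hq : q ≠ 0) (hq2 : q ^ 2 ≠ 1) (M : ℕ) {Mp : ℕ}
    (hMp : Mp ≤ n) (ξ ξp : ℂ) (hT : IsLaurent T)
    (hex : ∀ z w : ℂ, z ≠ 0 → w ≠ 0 → Exchange (Raff n q (z / w)) (T z) (T w))
    (hω : IsHighestWeight T ω P) {z : ℂ} (hz : Regular q T P z) :
    (transfer q M Mp ξ ξp T z).HasEigenvector (Lambda0 q M Mp ξ ξp P z) ω := by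
  rw [Module.End.hasEigenvector_iff, Module.End.mem_eigenspace_iff]
  refine ⟨?_, hω.ne_zero⟩
  rw [transfer, trace_scalarDiag_mul_apply]
  simp only [reflMonodromy_apply hq hq2 M ξ hT hex hω hz, smul_smul]
  rw [← Finset.sum_smul, sum_Kplus_mul_reflWeight hq M hMp ξ ξp hz.ne_zero hz.bfun_ne_zero,
    Lambda0]
  congr 1
  exact Finset.sum_congr rfl fun j _ => by ring

end Reflection

/-! ### Products of matrices with commuting entries. -/

section Products

variable {n : ℕ} {A : Type*} [Ring A]

/-- Every entry of `X` commutes with every entry of `Y`. -/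
def EntryCommute (X Y : Matrix (Fin n) (Fin n) A) : Prop :=
  ∀ a b c d, Commute (X a b) (Y c d)

lemma EntryCommute.symm {X Y : Matrix (Fin n) (Fin n) A} (h : EntryCommute X Y) :
    EntryCommute Y X :=
  fun a b c d => (h c d a b).symm

lemma EntryCommute.list_prod {X : Matrix (Fin n) (Fin n) A}
    {l : List (Matrix (Fin n) (Fin n) A)} (h : ∀ Y ∈ l, EntryCommute X Y) :
    EntryCommute X l.prod := by
  induction l with
  | nil =>
    intro a b c d
    rw [List.prod_nil, Matrix.one_apply]
    split_ifs
    · exact Commute.one_right _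
    · exact Commute.zero_right _
  | cons Y l ih =>
    intro a b c d
    rw [List.prod_cons, Matrix.mul_apply]
    exact Commute.sum_right _ _ _ fun e _ =>
      (h Y (by simp) a b c e).mul_right (ih (fun Y hY => h Y (by simp [hY])) a b e d)

lemma EntryCommute.leg1_mul_leg2 {X Y : Matrix (Fin n) (Fin n) A}
    (h : EntryCommute X Y) : leg1 X * leg2 Y = leg2 Y * leg1 X := by
  ext ⟨i, j⟩ ⟨k, l⟩
  simpa [leg1, leg2, Matrix.mul_apply, Matrix.one_apply, Fintype.sum_prod_type]
    using (h i k j l).eq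

/-- The train argument: factors at different sites commute, so `R` is moved past one pair of factors
at a time. -/
lemma Exchange.list_prod [Algebra ℂ A] {R : Matrix (Fin n × Fin n) (Fin n × Fin n) ℂ} {N : ℕ}
    {X Y : Fin N → Matrix (Fin n) (Fin n) A} (h : ∀ i, Exchange R (X i) (Y i))
    (hc : ∀ i j, i ≠ j → EntryCommute (X i) (Y j)) :
    Exchange R (List.ofFn X).prod (List.ofFn Y).prod := by
  induction N with
  | zero => simp [Exchange, leg1_one, leg2_one]
  | succ N ih =>
    have h0 : R.map (algebraMap ℂ A) * leg1 (X 0) * leg2 (Y 0) =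
      leg2 (Y 0) * leg1 (X 0) * R.map (algebraMap ℂ A) := h 0
    have h1 : R.map (algebraMap ℂ A) * leg1 (List.ofFn fun i : Fin N => X i.succ).prod *
        leg2 (List.ofFn fun i : Fin N => Y i.succ).prod =
      leg2 (List.ofFn fun i : Fin N => Y i.succ).prod *
        leg1 (List.ofFn fun i : Fin N => X i.succ).prod * R.map (algebraMap ℂ A) :=
      ih (fun i => h i.succ) fun i j hij =>
        hc _ _ fun h' => hij (Fin.succ_injective _ h')
    have c1 : leg1 (List.ofFn fun i : Fin N => X i.succ).prod * leg2 (Y 0) =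
        leg2 (Y 0) * leg1 (List.ofFn fun i : Fin N => X i.succ).prod := by
      refine (EntryCommute.symm (.list_prod fun Z hZ => ?_)).leg1_mul_leg2
      obtain ⟨i, rfl⟩ := (List.mem_ofFn' _ _).mp hZ
      exact (hc _ _ (Fin.succ_ne_zero i)).symm
    have c2 : leg1 (X 0) * leg2 (List.ofFn fun i : Fin N => Y i.succ).prod =
        leg2 (List.ofFn fun i : Fin N => Y i.succ).prod * leg1 (X 0) := by
      refine (EntryCommute.list_prod fun Z hZ => ?_).leg1_mul_leg2
      obtain ⟨i, rfl⟩ := (List.mem_ofFn' _ _).mp hZ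
      exact hc _ _ (Fin.succ_ne_zero i).symm
    rw [Exchange, List.ofFn_succ, List.ofFn_succ, List.prod_cons, List.prod_cons, leg1_mul,
      leg2_mul]
    set X' := leg1 (List.ofFn fun i : Fin N => X i.succ).prod
    set Y' := leg2 (List.ofFn fun i : Fin N => Y i.succ).prod
    set r := R.map (algebraMap ℂ A)
    calc r * (leg1 (X 0) * X') * (leg2 (Y 0) * Y')
        = r * leg1 (X 0) * (X' * leg2 (Y 0)) * Y' := by simp only [mul_assoc]
      _ = (r * leg1 (X 0) * leg2 (Y 0)) * X' * Y' := by rw [c1]; simp only [mul_assoc]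
      _ = leg2 (Y 0) * leg1 (X 0) * (r * X' * Y') := by rw [h0]; simp only [mul_assoc]
      _ = leg2 (Y 0) * (leg1 (X 0) * Y') * X' * r := by rw [h1]; simp only [mul_assoc]
      _ = leg2 (Y 0) * Y' * (leg1 (X 0) * X') * r := by rw [c2]; simp only [mul_assoc]

lemma IsLaurent.list_prod [Algebra ℂ A] {N : ℕ} {X : ℂ → Fin N → A}
    (h : ∀ i, IsLaurent fun z => X z i) : IsLaurent fun z => (List.ofFn (X z)).prod := by
  induction N with
  | zero => simpa using isLaurent_const (1 : A)
  | succ N ih =>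
    simp only [List.ofFn_succ, List.prod_cons]
    exact (h 0).mul (ih fun i => h i.succ)

/-- In the `(a, b)` entry of a product of two factors, summands with `c < a` die because the first
factor can be commuted to act on `ω`, and those with `c > b` die by the second. Nothing remains if
`b < a`, and only `c = a` if `b = a`. -/
lemma list_prod_apply_highestWeight {W : Type*} [AddCommGroup W] [Module ℂ W] {N : ℕ}
    {X : Fin N → Matrix (Fin n) (Fin n) (Module.End ℂ W)} {ω : W} {p : Fin N → Fin n → ℂ}
    (h0 : ∀ i a b, b < a → X i a b ω = 0) (h1 : ∀ i a, X i a a ω = p i a • ω)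
    (hc : ∀ i j, i ≠ j → EntryCommute (X i) (X j)) :
    (∀ a b, b < a → (List.ofFn X).prod a b ω = 0) ∧
      ∀ a, (List.ofFn X).prod a a ω = (∏ i, p i a) • ω := by
  induction N with
  | zero =>
    refine ⟨fun a b hab => ?_, fun a => ?_⟩
    · simp [Matrix.one_apply_ne hab.ne']
    · simp
  | succ N ih =>
    obtain ⟨t0, t1⟩ := ih (X := fun i => X i.succ) (p := fun i => p i.succ)
      (fun i => h0 i.succ) (fun i => h1 i.succ) fun i j hij =>
        hc _ _ fun h' => hij (Fin.succ_injective _ h')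
    have hcomm : EntryCommute (X 0) (List.ofFn fun i : Fin N => X i.succ).prod := by
      refine EntryCommute.list_prod fun Z hZ => ?_
      obtain ⟨i, rfl⟩ := (List.mem_ofFn' _ _).mp hZ
      exact hc _ _ (Fin.succ_ne_zero i).symm
    rw [List.ofFn_succ, List.prod_cons]
    set Y := (List.ofFn fun i : Fin N => X i.succ).prod
    have hlow : ∀ a b c, c < a → (X 0 a c) (Y c b ω) = 0 := fun a b c hca => by
      rw [← Module.End.mul_apply, (hcomm a c c b).eq, Module.End.mul_apply, h0 0 a c hca, map_zero]
    refine ⟨fun a b hab => ?_, fun a => ?_⟩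
    · rw [Matrix.mul_apply, LinearMap.sum_apply]
      refine Finset.sum_eq_zero fun c _ => ?_
      rw [Module.End.mul_apply]
      by_cases hca : c < a
      · exact hlow a b c hca
      · rw [t0 c b (hab.trans_le (not_lt.mp hca)), map_zero]
    · rw [Matrix.mul_apply, LinearMap.sum_apply, Finset.sum_eq_single a]
      · rw [Module.End.mul_apply, t1, map_smul, h1, smul_smul, Fin.prod_univ_succ, mul_comm]
      · intro c _ hc
        rw [Module.End.mul_apply]
        rcases lt_or_gt_of_ne hc with h | h
        · exact hlow a a c h
        · rw [t0 c a h, map_zero]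
      · simp

end Products

/-! ### Operators at the sites of the tensor product. -/

section Sites

variable {n N : ℕ} {V : Fin N → Type*} [∀ i, AddCommGroup (V i)] [∀ i, Module ℂ (V i)]

lemma siteOp_tprod (i : Fin N) (f : Module.End ℂ (V i)) (v : ∀ j, V j) :
    siteOp i f (PiTensorProduct.tprod ℂ v) =
      PiTensorProduct.tprod ℂ (Function.update v i (f (v i))) := by
  rw [siteOp, PiTensorProduct.map_tprod]
  congr 1
  ext j
  by_cases h : j = i
  · subst h; simp
  · simp [h]

lemma siteOp_mul (i : Fin N) (f g : Module.End ℂ (V i)) :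
    siteOp i (f * g) = siteOp i f * siteOp i g := by
  refine PiTensorProduct.ext (MultilinearMap.ext fun v => ?_)
  simp [siteOp_tprod]

lemma siteOp_one (i : Fin N) : siteOp i (1 : Module.End ℂ (V i)) = 1 := by
  refine PiTensorProduct.ext (MultilinearMap.ext fun v => ?_)
  simp [siteOp_tprod]

/-- `siteOp i` as an algebra homomorphism. -/
noncomputable def siteAlgHom (i : Fin N) : Module.End ℂ (V i) →ₐ[ℂ] Module.End ℂ (⨂[ℂ] j, V j) :=
  AlgHom.ofLinearMap
    { toFun := siteOp i
      map_add' := fun f g => PiTensorProduct.map_update_add _ i f g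
      map_smul' := fun c f => PiTensorProduct.map_update_smul _ i c f }
    (siteOp_one i) (siteOp_mul i)

lemma siteOp_commute {i j : Fin N} (hij : i ≠ j) (f : Module.End ℂ (V i))
    (g : Module.End ℂ (V j)) : Commute (siteOp i f) (siteOp j g) := by
  refine PiTensorProduct.ext (MultilinearMap.ext fun v => ?_)
  simp [siteOp_tprod, hij, hij.symm, Function.update_comm hij]

lemma monodromy_eq (t : Fin N → ℂ) (L : ∀ i, ℂ → Matrix (Fin n) (Fin n) (Module.End ℂ (V i)))
    (z : ℂ) : monodromy t L z =
      (List.ofFn fun i => (siteAlgHom i).mapMatrix (L i (z * t i))).prod := rfl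

lemma entryCommute_sites {i j : Fin N} (hij : i ≠ j)
    (X : Matrix (Fin n) (Fin n) (Module.End ℂ (V i)))
    (Y : Matrix (Fin n) (Fin n) (Module.End ℂ (V j))) :
    EntryCommute ((siteAlgHom i).mapMatrix X) ((siteAlgHom j).mapMatrix Y) :=
  fun _ _ _ _ => siteOp_commute hij _ _

lemma Exchange.map {A B : Type*} [Ring A] [Algebra ℂ A] [Ring B] [Algebra ℂ B]
    {R : Matrix (Fin n × Fin n) (Fin n × Fin n) ℂ} {X Y : Matrix (Fin n) (Fin n) A}
    (h : Exchange R X Y) (φ : A →ₐ[ℂ] B) : Exchange R (φ.mapMatrix X) (φ.mapMatrix Y) := by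
  have h1 : ∀ X, leg1 (φ.mapMatrix X) = φ.mapMatrix (m := Fin n × Fin n) (leg1 X) := by
    intro X
    ext ⟨i, j⟩ ⟨k, l⟩
    by_cases hjl : j = l <;> simp [leg1, hjl]
  have h2 : ∀ X, leg2 (φ.mapMatrix X) = φ.mapMatrix (m := Fin n × Fin n) (leg2 X) := by
    intro X
    ext ⟨i, j⟩ ⟨k, l⟩
    by_cases hik : i = k <;> simp [leg2, hik]
  have h3 : R.map (algebraMap ℂ B) =
      φ.mapMatrix (m := Fin n × Fin n) (R.map (algebraMap ℂ A)) := by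
    ext r s
    simp
  have := congrArg (φ.mapMatrix (m := Fin n × Fin n)) h
  rw [Exchange, h1, h2, h3]
  simpa only [map_mul] using this

lemma monodromy_exchange {q : ℂ} {t : Fin N → ℂ} (ht : ∀ i, t i ≠ 0)
    {L : ∀ i, ℂ → Matrix (Fin n) (Fin n) (Module.End ℂ (V i))}
    (hL : ∀ i, ∀ z w : ℂ, z ≠ 0 → w ≠ 0 → Exchange (Raff n q (z / w)) (L i z) (L i w))
    (z w : ℂ) (hz : z ≠ 0) (hw : w ≠ 0) :
    Exchange (Raff n q (z / w)) (monodromy t L z) (monodromy t L w) := by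
  rw [monodromy_eq, monodromy_eq]
  refine Exchange.list_prod (fun i => ?_) fun i j hij => entryCommute_sites hij _ _
  have := hL i (z * t i) (w * t i) (mul_ne_zero hz (ht i)) (mul_ne_zero hw (ht i))
  rw [mul_div_mul_right _ _ (ht i)] at this
  exact this.map _

lemma isLaurent_monodromy {t : Fin N → ℂ} (ht : ∀ i, t i ≠ 0)
    {L : ∀ i, ℂ → Matrix (Fin n) (Fin n) (Module.End ℂ (V i))} (hL : ∀ i, IsLaurent (L i)) :
    IsLaurent (monodromy t L) :=
  IsLaurent.list_prod fun i => ((hL i).comp_mul (ht i)).map (siteAlgHom i).mapMatrix.toLinearMap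

lemma IsLaxOperator.isLaurent {q : ℂ} {E : Type*} [AddCommGroup E] [Module ℂ E]
    {L : ℂ → Matrix (Fin n) (Fin n) (Module.End ℂ E)} (hL : IsLaxOperator q L) : IsLaurent L := by
  obtain ⟨d, c, hc⟩ := hL.laurent
  exact ⟨_, c, hc⟩

/-- Functionals that do not vanish on the factors multiply to one that does not vanish on the pure
tensor. -/
lemma tprod_ne_zero {v : ∀ i, V i} (hv : ∀ i, v i ≠ 0) : PiTensorProduct.tprod ℂ v ≠ 0 := by
  have : ∀ i, ∃ φ : Module.Dual ℂ (V i), φ (v i) ≠ 0 := fun i => by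
    by_contra! h
    exact hv i ((Module.forall_dual_apply_eq_zero_iff ℂ _).mp h)
  choose φ hφ using this
  intro h
  have h1 := congrArg (PiTensorProduct.lift
    ((MultilinearMap.mkPiAlgebra ℂ (Fin N) ℂ).compLinearMap φ)) h
  rw [PiTensorProduct.lift.tprod, map_zero] at h1
  simp only [MultilinearMap.compLinearMap_apply, MultilinearMap.mkPiAlgebra_apply] at h1
  exact Finset.prod_ne_zero_iff.mpr (fun i _ => hφ i) h1

end Sites

/-! ### Evaluation representations of the quantum group. -/

section Rep

variable {n : ℕ} {A : Type*} [Ring A] [Algebra ℂ A]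

/-- The flip of the two auxiliary spaces. -/
def flip (n : ℕ) (A : Type*) [Ring A] : Matrix (Fin n × Fin n) (Fin n × Fin n) A :=
  Matrix.of fun r s => if s = r.swap then 1 else 0

lemma flip_mul_apply {A : Type*} [Ring A] (X : Matrix (Fin n × Fin n) (Fin n × Fin n) A)
    (r s : Fin n × Fin n) : (flip n A * X) r s = X r.swap s := by
  simp [flip, Matrix.mul_apply]

lemma mul_flip_apply {A : Type*} [Ring A] (X : Matrix (Fin n × Fin n) (Fin n × Fin n) A)
    (r s : Fin n × Fin n) : (X * flip n A) r s = X r s.swap := by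
  have : ∀ u : Fin n × Fin n, s = u.swap ↔ u = s.swap := fun u =>
    ⟨fun h => by rw [h, Prod.swap_swap], fun h => by rw [h, Prod.swap_swap]⟩
  simp [flip, Matrix.mul_apply, this]

lemma flip_mul_flip {A : Type*} [Ring A] : flip n A * flip n A = 1 := by
  ext r s
  rw [flip_mul_apply, flip, Matrix.of_apply, Prod.swap_swap, Matrix.one_apply]
  simp only [eq_comm]

lemma flip_mul_leg1 {A : Type*} [Ring A] (X : Matrix (Fin n) (Fin n) A) :
    flip n A * leg1 X = leg2 X * flip n A := by
  ext ⟨a, b⟩ ⟨c, d⟩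
  rw [flip_mul_apply, mul_flip_apply]
  simp [leg1, leg2, Matrix.one_apply]

lemma flip_mul_leg2 {A : Type*} [Ring A] (X : Matrix (Fin n) (Fin n) A) :
    flip n A * leg2 X = leg1 X * flip n A := by
  ext ⟨a, b⟩ ⟨c, d⟩
  rw [flip_mul_apply, mul_flip_apply]
  simp [leg1, leg2, Matrix.one_apply]

/-- The Hecke relation for `Ř = P R`. -/
lemma hecke {q : ℂ} (hq : q ≠ 0) :
    flip n ℂ * Rfin n q * (flip n ℂ * Rfin n q) =
      (q - q⁻¹) • (flip n ℂ * Rfin n q) + 1 := by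
  have hent : ∀ r s : Fin n × Fin n, (flip n ℂ * Rfin n q) r s =
      (if s = r then (if r.2 < r.1 then q - q⁻¹ else if r.1 = r.2 then q else 0) else 0) +
        (if s = r.swap then (if r.1 = r.2 then 0 else 1) else 0) := by
    rintro ⟨a, b⟩ ⟨c, d⟩
    rw [flip_mul_apply]
    simp only [Rfin, Matrix.of_apply, Prod.swap, Prod.mk.injEq]
    rcases lt_trichotomy a b with h | h | h
    · grind
    · grind
    · grind
  ext r s
  rw [Matrix.mul_apply, Matrix.add_apply, Matrix.smul_apply]
  have h1 : ∀ u, (flip n ℂ * Rfin n q) r u * (flip n ℂ * Rfin n q) u s =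
      (if u = r then (if r.2 < r.1 then q - q⁻¹ else if r.1 = r.2 then q else 0) *
        (flip n ℂ * Rfin n q) r s else 0) +
        (if u = r.swap then (if r.1 = r.2 then 0 else 1) *
          (flip n ℂ * Rfin n q) r.swap s else 0) := by
    intro u
    rw [hent r u, add_mul]
    congr 1
    · by_cases h : u = r
      · rw [if_pos h, if_pos h, h]
      · rw [if_neg h, if_neg h, zero_mul]
    · by_cases h : u = r.swap
      · rw [if_pos h, if_pos h, h]
      · rw [if_neg h, if_neg h, zero_mul]
  simp only [h1, Finset.sum_add_distrib, Finset.sum_ite_eq', Finset.mem_univ, if_true]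
  rw [hent, hent, Matrix.one_apply, Prod.swap_swap]
  obtain ⟨a, b⟩ := r
  simp only [Prod.swap, smul_eq_mul, @eq_comm _ (a, b) s]
  rcases lt_trichotomy a b with h | h | h
  · have h2 : ¬ b < a := h.not_gt
    simp only [h, h2, h.ne, h.ne', if_true, if_false]
    split_ifs <;> ring
  · subst h
    simp only [lt_irrefl, if_true, if_false]
    split_ifs
    · field_simp
      ring
    · ring
  · have h2 : ¬ a < b := h.not_gt
    simp only [h, h2, h.ne, h.ne', if_true, if_false]
    split_ifs <;> ring

/-- Affinization of the finite `R`-matrix. -/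
lemma Raff_eq (q x : ℂ) :
    Raff n q x = x • Rfin n q - x⁻¹ • (Rfin n q - (q - q⁻¹) • flip n ℂ) := by
  ext ⟨a, b⟩ ⟨c, d⟩
  simp only [Raff, Rfin, flip, Matrix.of_apply, Matrix.sub_apply, Matrix.smul_apply, smul_eq_mul,
    Prod.swap, Prod.mk.injEq, afun, bfun, mul_inv]
  rcases lt_trichotomy a b with h | h | h
  · grind
  · grind
  · grind

/-- Baxterization: the affine exchange relation for `z ℒ⁺ - z⁻¹ ℒ⁻`, as an identity in an algebra
containing the `R`-matrix, the flip and the two copies of `ℒ^±`. -/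
lemma baxterization {B : Type*} [Ring B] [Algebra ℂ B] {κ : ℂ} {R F X₁ X₂ Y₁ Y₂ : B}
    (hF : F * F = 1) (hX1 : F * X₁ = X₂ * F) (hX2 : F * X₂ = X₁ * F) (hY1 : F * Y₁ = Y₂ * F)
    (hY2 : F * Y₂ = Y₁ * F) (hecke : F * R * (F * R) = κ • (F * R) + 1)
    (hXX : R * X₁ * X₂ = X₂ * X₁ * R) (hXY : R * X₁ * Y₂ = Y₂ * X₁ * R)
    (hYY : R * Y₁ * Y₂ = Y₂ * Y₁ * R) {z w : ℂ} (hz : z ≠ 0) (hw : w ≠ 0) :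
    ((z / w) • R - (z / w)⁻¹ • (R - κ • F)) * (z • X₁ - z⁻¹ • Y₁) * (w • X₂ - w⁻¹ • Y₂) =
      (w • X₂ - w⁻¹ • Y₂) * (z • X₁ - z⁻¹ • Y₁) *
        ((z / w) • R - (z / w)⁻¹ • (R - κ • F)) := by
  have fXX : F * X₁ * X₂ = X₂ * X₁ * F := by rw [hX1, mul_assoc, hX2, mul_assoc]
  have fYY : F * Y₁ * Y₂ = Y₂ * Y₁ * F := by rw [hY1, mul_assoc, hY2, mul_assoc]
  have fXY : F * X₁ * Y₂ = X₂ * Y₁ * F := by rw [hX1, mul_assoc, hY2, mul_assoc]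
  have fYX : F * Y₁ * X₂ = Y₂ * X₁ * F := by rw [hY1, mul_assoc, hX2, mul_assoc]
  -- By the Hecke relation, `R - κ • F` is the two-sided inverse of `F * R * F`, the matrix `R₂₁`.
  have i1 : F * R * F * (R - κ • F) = 1 := by
    rw [mul_sub, mul_smul_comm, mul_assoc (F * R) F F, hF, mul_one, mul_assoc, hecke]
    abel
  have i2 : (R - κ • F) * (F * R * F) = 1 := by
    have : R * F * R = κ • R + F := by
      have := congrArg (F * ·) hecke
      simpa only [mul_add, mul_smul_comm, mul_one, ← mul_assoc, hF, one_mul] using this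
    rw [sub_mul, smul_mul_assoc]
    simp only [← mul_assoc]
    rw [this, hF, one_mul, add_mul, smul_mul_assoc, hF]
    abel
  have sXY : F * R * F * (X₂ * Y₁) = Y₁ * X₂ * (F * R * F) := by
    calc F * R * F * (X₂ * Y₁) = F * R * (F * X₂) * Y₁ := by simp only [mul_assoc]
      _ = F * (R * X₁ * (F * Y₁)) := by rw [hX2]; simp only [mul_assoc]
      _ = F * (R * X₁ * Y₂) * F := by rw [hY1]; simp only [mul_assoc]
      _ = F * Y₂ * X₁ * R * F := by rw [hXY]; simp only [mul_assoc]
      _ = Y₁ * (F * X₁) * R * F := by rw [hY2]; simp only [mul_assoc]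
      _ = Y₁ * X₂ * (F * R * F) := by rw [hX1]; simp only [mul_assoc]
  -- The mixed relation in the order `(-, +)` is not assumed. It follows from the `(+, -)` relation,
  -- conjugated by the flip and then by `R₂₁⁻¹`.
  have rYX : (R - κ • F) * (Y₁ * X₂) = X₂ * Y₁ * (R - κ • F) := by
    calc (R - κ • F) * (Y₁ * X₂)
        = (R - κ • F) * (Y₁ * X₂ * (F * R * F)) * (R - κ • F) := by
          rw [mul_assoc _ _ (R - κ • F), mul_assoc _ _ (R - κ • F), i1, mul_one]
      _ = _ := by rw [← sXY, ← mul_assoc, i2, one_mul]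
  simp only [sub_mul, smul_mul_assoc, mul_sub, mul_smul_comm] at rYX
  simp only [← mul_assoc] at rYX
  have rYX' : R * Y₁ * X₂ = X₂ * Y₁ * R - κ • (X₂ * Y₁ * F) + κ • (Y₂ * X₁ * F) := by
    rw [← rYX, fYX]; abel
  simp only [sub_mul, smul_mul_assoc, mul_sub, mul_smul_comm]
  rw [hXX, hXY, hYY, rYX', fXX, fXY, fYX, fYY]
  match_scalars <;> field_simp <;> ring

variable {q : ℂ} {V : Type*} [AddCommGroup V] [Module ℂ V]

lemma UqGlRep.lax_exchange (hq : q ≠ 0) (ρ : UqGlRep n q V) {z w : ℂ} (hz : z ≠ 0) (hw : w ≠ 0) :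
    Exchange (Raff n q (z / w)) (ρ.lax z) (ρ.lax w) := by
  set A := Module.End ℂ V
  have hmap : (flip n ℂ).map (algebraMap ℂ A) = flip n A := by
    ext r s
    simp only [flip, Matrix.map_apply, Matrix.of_apply]
    split_ifs <;> simp
  let φ : Matrix (Fin n × Fin n) (Fin n × Fin n) ℂ →ₐ[ℂ]
      Matrix (Fin n × Fin n) (Fin n × Fin n) A := (Algebra.ofId ℂ A).mapMatrix
  have hφ : ∀ X, X.map (algebraMap ℂ A) = φ X := fun X => rfl
  have hφF : φ (flip n ℂ) = flip n A := hmap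
  have hR : (Raff n q (z / w)).map (algebraMap ℂ A) = (z / w) • φ (Rfin n q) -
      (z / w)⁻¹ • (φ (Rfin n q) - (q - q⁻¹) • flip n A) := by
    rw [hφ, Raff_eq, map_sub, map_smul, map_smul, map_sub, map_smul, hφF]
  have hecke' : flip n A * φ (Rfin n q) * (flip n A * φ (Rfin n q)) =
      (q - q⁻¹) • (flip n A * φ (Rfin n q)) + 1 := by
    rw [← hφF, ← map_mul, ← map_mul, hecke hq, map_add, map_smul, map_one]
  have l1 : ∀ u : ℂ, leg1 (ρ.lax u) = u • leg1 ρ.ellP - u⁻¹ • leg1 ρ.ellM := by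
    intro u
    ext1 r s
    simp [leg1, UqGlRep.lax, sub_mul]
  have l2 : ∀ u : ℂ, leg2 (ρ.lax u) = u • leg2 ρ.ellP - u⁻¹ • leg2 ρ.ellM := by
    intro u
    ext1 r s
    simp [leg2, UqGlRep.lax, mul_sub]
  rw [Exchange, hR, l1, l2]
  exact baxterization flip_mul_flip (flip_mul_leg1 _) (flip_mul_leg2 _) (flip_mul_leg1 _)
    (flip_mul_leg2 _) hecke' ρ.exch_PP ρ.exch_PM ρ.exch_MM hz hw

lemma UqGlRep.isLaurent_lax (ρ : UqGlRep n q V) : IsLaurent ρ.lax :=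
  ((isLaurent_zpow_smul 1 ρ.ellP).sub (isLaurent_zpow_smul (-1) ρ.ellM)).congr fun z _ => by
    simp [UqGlRep.lax]

lemma UqGlRep.IsHighestWeight.lax_lower {ρ : UqGlRep n q V} {v : V} {lam : Fin n → ℂ}
    (h : ρ.IsHighestWeight v lam) (z : ℂ) {a b : Fin n} (hab : b < a) : ρ.lax z a b v = 0 := by
  simp [UqGlRep.lax, ρ.upper a b hab, h.lower a b hab]

lemma UqGlRep.IsHighestWeight.lax_diag {ρ : UqGlRep n q V} {v : V} {lam : Fin n → ℂ}
    (h : ρ.IsHighestWeight v lam) (z : ℂ) (a : Fin n) :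
    ρ.lax z a a v = (z * lam a - z⁻¹ * (lam a)⁻¹) • v := by
  have h1 : ρ.ellP a a v = lam a • v := by
    have := congrArg (fun f => f v) (ρ.diag_mul a)
    simp only [Module.End.mul_apply, h.diag, map_smul, Module.End.one_apply] at this
    nth_rewrite 2 [← this]
    rw [smul_smul, mul_inv_cancel₀ (h.lam_ne_zero a), one_smul]
  simp only [UqGlRep.lax, Matrix.sub_apply, Matrix.smul_apply, LinearMap.sub_apply,
    LinearMap.smul_apply, h1, h.diag]
  module

lemma isHighestWeight_tprod {N : ℕ} {V : Fin N → Type*} [∀ i, AddCommGroup (V i)]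
    [∀ i, Module ℂ (V i)] (t : Fin N → ℂ) (ρ : ∀ i, UqGlRep n q (V i)) {v : ∀ i, V i}
    {lam : Fin N → Fin n → ℂ} (h : ∀ i, (ρ i).IsHighestWeight (v i) (lam i)) :
    OpenChain.IsHighestWeight (monodromy t fun i => (ρ i).lax) (PiTensorProduct.tprod ℂ v)
      (chainWeight t lam) := by
  have key := fun z : ℂ => list_prod_apply_highestWeight
    (X := fun i => (siteAlgHom i).mapMatrix ((ρ i).lax (z * t i)))
    (ω := PiTensorProduct.tprod ℂ v)
    (p := fun i a => z * (t i * lam i a) - z⁻¹ * (t i * lam i a)⁻¹)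
    (fun i a b hab => by
      change siteOp i _ _ = 0
      rw [siteOp_tprod, (h i).lax_lower _ hab]
      exact (PiTensorProduct.tprod ℂ).map_update_zero _ _)
    (fun i a => by
      change siteOp i _ _ = _
      rw [siteOp_tprod, (h i).lax_diag, MultilinearMap.map_update_smul, Function.update_eq_self]
      congr 1
      rw [mul_inv, mul_inv]
      ring)
    fun i j hij => entryCommute_sites hij _ _
  exact ⟨tprod_ne_zero fun i => (h i).ne_zero, fun z _ => (key z).1, fun z _ => (key z).2⟩

end Rep

/-! ### Finiteness of the set of irregular spectral parameters. -/

section Finiteness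

variable {n : ℕ} {q : ℂ}

/-- Every spectral value is a root of the minimal polynomial. -/
lemma finite_spectrum {A : Type*} [Ring A] [Algebra ℂ A] [Module.Finite ℂ A] (a : A) :
    (spectrum ℂ a).Finite := by
  refine ((minpoly ℂ a).rootSet_finite ℂ).subset fun r hr => ?_
  rw [Polynomial.mem_rootSet]
  refine ⟨minpoly.ne_zero (Algebra.IsIntegral.isIntegral a), ?_⟩
  have h := spectrum.subset_polynomial_aeval a (minpoly ℂ a) ⟨r, hr, rfl⟩
  rw [minpoly.aeval, spectrum.mem_iff, sub_zero] at h
  by_contra h0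
  refine h ((IsUnit.mk0 _ ?_).map (algebraMap ℂ A))
  simpa [Polynomial.aeval_def] using h0

lemma finite_pow_eq {m : ℕ} (hm : m ≠ 0) (c : ℂ) : {z : ℂ | z ^ m = c}.Finite := by
  refine (Polynomial.nthRoots m c).toFinset.finite_toSet.subset fun z hz => ?_
  simpa [Polynomial.mem_nthRoots (Nat.pos_of_ne_zero hm)] using hz

/-- A lower triangular matrix over a finite-dimensional algebra with invertible diagonal entries is
invertible. -/
lemma isUnit_of_lower {A : Type*} [Ring A] [Algebra ℂ A] [Module.Finite ℂ A]
    {X : Matrix (Fin n) (Fin n) A} (hX : ∀ a b, a < b → X a b = 0) (hd : ∀ a, IsUnit (X a a)) :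
    IsUnit X := by
  have : IsArtinianRing (Matrix (Fin n) (Fin n) A) := IsArtinianRing.of_finite ℂ _
  -- In a finite-dimensional algebra it is enough that `Y * X = 0` forces `Y = 0`; triangularity
  -- gives this column by column, from the last one backwards.
  rw [IsArtinianRing.isUnit_iff_isRightRegular, isRightRegular_iff_left_eq_zero_of_mul]
  intro Y hY
  ext i j
  rw [Matrix.zero_apply]
  induction hk : n - (j : ℕ) using Nat.strong_induction_on generalizing j with
  | _ k ih =>
    have h := congrFun (congrFun hY i) j
    rw [Matrix.mul_apply, Finset.sum_eq_single j] at h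
    · exact (hd j).mul_left_eq_zero.mp h
    · intro l _ hl
      rcases lt_or_gt_of_ne hl with h' | h'
      · rw [hX l j h', mul_zero]
      · have := Fin.lt_def.mp h'
        rw [ih _ (by omega) l rfl, zero_mul]
    · simp

/-- Since `ℒ⁻` is invertible, `ℒ(u) = -u ℒ⁻ (u⁻² - (ℒ⁻)⁻¹ ℒ⁺)` fails to be invertible only if `u⁻²`
lies in the finite spectrum of `(ℒ⁻)⁻¹ ℒ⁺`. -/
lemma UqGlRep.finite_not_isUnit_lax {V : Type*} [AddCommGroup V] [Module ℂ V]
    [FiniteDimensional ℂ V] (ρ : UqGlRep n q V) :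
    {u : ℂ | u ≠ 0 ∧ ¬ IsUnit (ρ.lax u)}.Finite := by
  obtain ⟨m, hm⟩ := isUnit_of_lower ρ.lower fun a =>
    ⟨⟨_, _, ρ.diag_mul' a, ρ.diag_mul a⟩, rfl⟩
  set X := (↑m⁻¹ : Matrix (Fin n) (Fin n) (Module.End ℂ V)) * ρ.ellP with hX
  refine ((finite_spectrum X).biUnion fun r _ => finite_pow_eq two_ne_zero r⁻¹).subset ?_
  rintro u ⟨hu, hnu⟩
  simp only [Set.mem_iUnion, Set.mem_ofPred_eq, exists_prop]
  refine ⟨(u ^ 2)⁻¹, ?_, (inv_inv _).symm⟩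
  rw [spectrum.mem_iff]
  intro hunit
  refine hnu ?_
  have : ρ.lax u = (-u) • (ρ.ellM * (algebraMap ℂ _ (u ^ 2)⁻¹ - X)) := by
    rw [mul_sub, hX, ← hm, ← mul_assoc, Units.mul_inv, one_mul, UqGlRep.lax, ← hm,
      ← Algebra.commutes, ← Algebra.smul_def]
    match_scalars <;> field_simp
  rw [this, Algebra.smul_def]
  exact ((IsUnit.mk0 _ (neg_ne_zero.mpr hu)).map (algebraMap ℂ _)).mul
    ((hm ▸ m.isUnit).mul hunit)

lemma finite_not_regular (hq : q ≠ 0) {N : ℕ} {V : Fin N → Type*} [∀ i, AddCommGroup (V i)]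
    [∀ i, Module ℂ (V i)] [∀ i, FiniteDimensional ℂ (V i)] {t : Fin N → ℂ} (ht : ∀ i, t i ≠ 0)
    (ρ : ∀ i, UqGlRep n q (V i)) {lam : Fin N → Fin n → ℂ} (hlam : ∀ i a, lam i a ≠ 0) :
    {z : ℂ | ¬ Regular q (monodromy t fun i => (ρ i).lax) (chainWeight t lam) z}.Finite := by
  -- The site `i` enters the monodromy matrix at `z⁻¹` with argument `u = z⁻¹ * t i`, hence `z = t i
  -- / u`. The sets in `f2` and `f3` contain the zeros of `bfun (q ^ k * z ^ 2)` and of the weights.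
  have f1 : (⋃ i, (fun u => t i / u) '' {u : ℂ | u ≠ 0 ∧ ¬ IsUnit ((ρ i).lax u)}).Finite :=
    Set.finite_iUnion fun i => ((ρ i).finite_not_isUnit_lax).image _
  have f2 : (⋃ k ∈ Finset.range (n + 1), {z : ℂ | z ^ 4 = (q ^ (2 * k))⁻¹}).Finite :=
    (Finset.range (n + 1)).finite_toSet.biUnion fun k _ => finite_pow_eq (by norm_num) _
  have f3 : (⋃ (a : Fin n) (i : Fin N),
      {z : ℂ | z ^ 2 = (q ^ (-(a : ℤ)) * (t i * lam i a)) ^ 2}).Finite :=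
    Set.finite_iUnion fun a => Set.finite_iUnion fun i => finite_pow_eq two_ne_zero _
  refine ((((Set.finite_singleton (0 : ℂ)).union f1).union f2).union f3).subset fun z hz => ?_
  by_contra hmem
  simp only [Set.mem_union, not_or, Set.mem_singleton_iff, Set.mem_iUnion, Set.mem_image,
    Set.mem_ofPred_eq, not_exists, not_and, and_imp, Finset.mem_range] at hmem
  obtain ⟨⟨⟨h0, h1⟩, h2⟩, h3⟩ := hmem
  refine hz ⟨h0, ?_, fun k hk hb => ?_, fun a ha => ?_⟩
  · rw [monodromy_eq]
    refine List.prod_isUnit fun X hX => ?_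
    obtain ⟨i, rfl⟩ := (List.mem_ofFn' _ _).mp hX
    refine IsUnit.map _ ?_
    by_contra hn
    refine h1 i _ (mul_ne_zero (inv_ne_zero h0) (ht i)) hn ?_
    have := ht i
    field_simp
  · rw [bfun_eq_zero_iff (mul_ne_zero (pow_ne_zero _ hq) (pow_ne_zero _ h0))] at hb
    refine h2 k (Nat.lt_succ_of_le hk) ?_
    refine eq_inv_of_mul_eq_one_left ?_
    rw [← hb]
    ring
  · rw [chainWeight, Finset.prod_eq_zero_iff] at ha
    obtain ⟨i, -, ha⟩ := ha
    have hc : t i * lam i a ≠ 0 := mul_ne_zero (ht i) (hlam i a)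
    have hqa : q ^ (-(a : ℤ)) ≠ 0 := zpow_ne_zero _ hq
    refine h3 a i ?_
    generalize q ^ (-(a : ℤ)) = r at *
    generalize t i * lam i a = c at *
    rw [sub_eq_zero] at ha
    field_simp at ha
    linear_combination -ha

end Finiteness

end OpenChain

theorem mainTheorem3 (n N : ℕ) (q : ℂ) (hq : q ≠ 0) (hq2 : q ^ 2 ≠ 1)
    (M Mp : ℕ) (hM : M ≤ n) (hMp : Mp ≤ n) (ξ ξp : ℂ)
    (V : Fin N → Type*) [∀ i, AddCommGroup (V i)] [∀ i, Module ℂ (V i)]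
    (t : Fin N → ℂ) (ht : ∀ i, t i ≠ 0) :
    (∀ L : ∀ i, ℂ → Matrix (Fin n) (Fin n) (Module.End ℂ (V i)),
      (∀ i, OpenChain.IsLaxOperator q (L i)) →
      ∀ (ω : PiTensorProduct ℂ V) (P : Fin n → ℂ → ℂ),
        OpenChain.IsHighestWeight (OpenChain.monodromy t L) ω P →
        ∀ z : ℂ, OpenChain.Regular q (OpenChain.monodromy t L) P z →
          (OpenChain.transfer q M Mp ξ ξp (OpenChain.monodromy t L) z).HasEigenvector
            (OpenChain.Lambda0 q M Mp ξ ξp P z) ω) ∧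
    (∀ (ρ : ∀ i, OpenChain.UqGlRep n q (V i)) (v : ∀ i, V i) (lam : Fin N → Fin n → ℂ),
      (∀ i, FiniteDimensional ℂ (V i)) →
      (∀ i, (ρ i).IsHighestWeight (v i) (lam i)) →
        {z : ℂ | ¬ OpenChain.Regular q (OpenChain.monodromy t fun i => (ρ i).lax)
          (OpenChain.chainWeight t lam) z}.Finite ∧
        ∀ z : ℂ, OpenChain.Regular q (OpenChain.monodromy t fun i => (ρ i).lax)
            (OpenChain.chainWeight t lam) z →
          (OpenChain.transfer q M Mp ξ ξp (OpenChain.monodromy t fun i => (ρ i).lax)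
            z).HasEigenvector
            (OpenChain.Lambda0 q M Mp ξ ξp (OpenChain.chainWeight t lam) z)
            (PiTensorProduct.tprod ℂ v)) := by
  refine ⟨fun L hL ω P hω z hz => ?_, fun ρ v lam hfin hv => ⟨?_, fun z hz => ?_⟩⟩
  · exact OpenChain.transfer_hasEigenvector hq hq2 M hMp ξ ξp
      (OpenChain.isLaurent_monodromy ht fun i => (hL i).isLaurent)
      (OpenChain.monodromy_exchange ht fun i => (hL i).exchange) hω hz
  · exact OpenChain.finite_not_regular hq ht ρ fun i => (hv i).lam_ne_zero
  · exact OpenChain.transfer_hasEigenvector hq hq2 M hMp ξ ξp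
      (OpenChain.isLaurent_monodromy ht fun i => (ρ i).isLaurent_lax)
      (OpenChain.monodromy_exchange ht fun i _ _ hz hw => (ρ i).lax_exchange hq hz hw)
      (OpenChain.isHighestWeight_tprod t ρ hv) hz
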